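/- A homogeneous polynomial vector field of degree $2$ on $\mathbb S^2=\{x^2+y^2+z^2=1\}$ is a vector field $X=(P,Q,R)$ on $\mathbb R^3$ whose components are real quadratic forms and which is tangent to $\mathbb S^2$, i.e. $xP+yQ+zR=0$ on $\mathbb S^2$. A singularity $p\in\mathbb S^2$ of $X$ is a center if all other points of $\mathbb S^2$ in some neighbourhood of $p$ lie on nonconstant periodic orbits. It is a weak focus if the linear part $DX(p)|_{T_p\mathbb S^2}$ has trace $0$ and positive determinant (equivalently, a pair of nonzero purely imaginary eigenvalues) and $p$ is not a center. Let $J\subseteq\mathbb R$ be open and let $(X_\mu)_{\mu\in J}$ be a family of homogeneous polynomial vector fields of degree $2$ on $\mathbb S^2$ whose coefficients are real-analytic functions of $\mu$. Suppose that the family has a Hopf bifurcation at $\mu_0\in J$: there is a curve $\mu\mapsto p(\mu)\in\mathbb S^2$, analytic at $\mu_0$, with $X_\mu(p(\mu))=0$ for $\mu$ near $\mu_0$, such that $p(\mu_0)$ is a weak focus of $X_{\mu_0}$ and the eigenvalues $\lambda(\mu)$ of $DX_\mu(p(\mu))|_{T_{p(\mu)}\mathbb S^2}$ satisfy $\frac{d}{d\mu}\operatorname{Re}\lambda(\mu)\big|_{\mu=\mu_0}\neq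 0$. Then there are an open neighbourhood $J'\subseteq J$ of $\mu_0$, orthogonal matrices $M(\mu)\in O(3)$ and real numbers $a_1(\mu),a_2(\mu),a_5(\mu),a_7(\mu),a_8(\mu)$, all depending analytically on $\mu\in J'$, such that for every $\mu\in J'$ the orthogonal linear change of variables $(x,y,z)\mapsto M(\mu)(x,y,z)$ brings the system associated to $X_\mu$ to the form \[ \begin{aligned} \dot x&=a_1xy+a_2y^2+a_5yz,\\ \dot y&=-a_1x^2-a_2xy+a_7xz+a_8yz,\\ \dot z&=-(a_5+a_7)xy-a_8y^2, \end{aligned} \] with $a_i=a_i(\mu)$, $a_1\neq0$, $a_2(a_5+a_7)-a_1a_8\neq0$ and $-a_5a_7<0$. -/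

import Mathlib

/-- A polynomial vector field `P ∂/∂x + Q ∂/∂y + R ∂/∂z` on `ℝ³`, given by its three components;
the variables `x, y, z` are `MvPolynomial.X 0, MvPolynomial.X 1, MvPolynomial.X 2`. -/
abbrev PolyField : Type := Fin 3 → MvPolynomial (Fin 3) ℝ

/-- The unit sphere `x² + y² + z² = 1`. -/
def unitSphere2 : Set (Fin 3 → ℝ) :=
  {x | x 0 ^ 2 + x 1 ^ 2 + x 2 ^ 2 = 1}

namespace PolyField

/-- The value of the vector field at a point. -/
noncomputable def vec (X : PolyField) (x : Fin 3 → ℝ) : Fin 3 → ℝ :=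
  fun i => MvPolynomial.eval x (X i)

/-- Homogeneous polynomial vector fields of degree `2` on the sphere: the components are
quadratic forms, and the field is tangent to the sphere at each of its points. -/
def IsQuadraticOnSphere (X : PolyField) : Prop :=
  (∀ i, (X i).IsHomogeneous 2) ∧
    ∀ x ∈ unitSphere2, x 0 * X.vec x 0 + x 1 * X.vec x 1 + x 2 * X.vec x 2 = 0

/-- `p` is a singularity of the vector field on the sphere. -/
def IsSingularity (X : PolyField) (p : Fin 3 → ℝ) : Prop :=
  p ∈ unitSphere2 ∧ X.vec p = 0

/-- The Jacobian matrix of the vector field at a point of `ℝ³`. -/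
noncomputable def jacobian (X : PolyField) (p : Fin 3 → ℝ) : Matrix (Fin 3) (Fin 3) ℝ :=
  Matrix.of fun i j => MvPolynomial.eval p (MvPolynomial.pderiv j (X i))

/-- `l` is a (complex) eigenvalue of the linear part, at the singularity `p`, of the restriction
of the field to the sphere: the eigenvectors are taken in the complexified tangent plane
`{w | ⟨p, w⟩ = 0}`, which the Jacobian matrix at a singularity leaves invariant. -/
def IsTangentEigenvalue (X : PolyField) (p : Fin 3 → ℝ) (l : ℂ) : Prop :=
  ∃ w : Fin 3 → ℂ, w ≠ 0 ∧ (p 0 : ℂ) * w 0 + (p 1 : ℂ) * w 1 + (p 2 : ℂ) * w 2 = 0 ∧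
    ((X.jacobian p).map (fun r : ℝ => (r : ℂ))).mulVec w = l • w

/-- `c` is a solution, defined for all times, of the differential system of the field. -/
def IsSolution (X : PolyField) (c : ℝ → Fin 3 → ℝ) : Prop :=
  ∀ t, HasDerivAt c (X.vec (c t)) t

/-- `p` is a center on the sphere: a singularity with a neighbourhood on the sphere all of whose
other points lie on nonconstant periodic orbits. -/
def IsCenter (X : PolyField) (p : Fin 3 → ℝ) : Prop :=
  X.IsSingularity p ∧ ∃ U ∈ nhds p, ∀ q ∈ U ∩ unitSphere2, q ≠ p →
    ∃ (c : ℝ → Fin 3 → ℝ) (T : ℝ), X.IsSolution c ∧ c 0 = q ∧ 0 < T ∧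
      (∀ t, c (t + T) = c t) ∧ ∃ t, c t ≠ q

/-- `p` is a weak focus on the sphere: a singularity whose linear part on the tangent plane has
a pair of nonzero purely imaginary eigenvalues (trace zero, positive determinant), and which is
not a center. -/
def IsWeakFocus (X : PolyField) (p : Fin 3 → ℝ) : Prop :=
  X.IsSingularity p ∧
    (∃ ω : ℝ, 0 < ω ∧ X.IsTangentEigenvalue p ((ω : ℂ) * Complex.I)) ∧
    ¬ X.IsCenter p

/-- The system `x' = a₁xy + a₂y² + a₅yz`, `y' = -a₁x² - a₂xy + a₇xz + a₈yz`,
`z' = -(a₅ + a₇)xy - a₈y²`. -/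
noncomputable def normalForm (a₁ a₂ a₅ a₇ a₈ : ℝ) : PolyField :=
  let x : MvPolynomial (Fin 3) ℝ := MvPolynomial.X 0
  let y : MvPolynomial (Fin 3) ℝ := MvPolynomial.X 1
  let z : MvPolynomial (Fin 3) ℝ := MvPolynomial.X 2
  ![MvPolynomial.C a₁ * x * y + MvPolynomial.C a₂ * y ^ 2 + MvPolynomial.C a₅ * y * z,
    -MvPolynomial.C a₁ * x ^ 2 - MvPolynomial.C a₂ * x * y + MvPolynomial.C a₇ * x * z
      + MvPolynomial.C a₈ * y * z,
    -MvPolynomial.C (a₅ + a₇) * x * y - MvPolynomial.C a₈ * y ^ 2]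

/-- An analytic one-parameter family, with parameter in `J`, of homogeneous polynomial vector
fields of degree `2` on the sphere. -/
def IsAnalyticFamily (J : Set ℝ) (X : ℝ → PolyField) : Prop :=
  (∀ μ ∈ J, (X μ).IsQuadraticOnSphere) ∧
    ∀ (i : Fin 3) (m : Fin 3 →₀ ℕ), AnalyticOnNhd ℝ (fun μ => MvPolynomial.coeff m (X μ i)) J

/-- The family has a Hopf bifurcation at the parameter value `μ₀`: there is an analytic curve
`p μ` of singularities on the sphere, `p μ₀` is a weak focus of `X μ₀`, and the real part of the
eigenvalues of the linear part at `p μ` crosses zero at `μ₀` with nonzero speed. -/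
def HasHopfBifurcationAt (X : ℝ → PolyField) (μ₀ : ℝ) : Prop :=
  ∃ p : ℝ → Fin 3 → ℝ, AnalyticAt ℝ p μ₀ ∧
    (∀ᶠ μ in nhds μ₀, (X μ).IsSingularity (p μ)) ∧
    (X μ₀).IsWeakFocus (p μ₀) ∧
    ∃ l : ℝ → ℂ, (∀ᶠ μ in nhds μ₀, (X μ).IsTangentEigenvalue (p μ) (l μ)) ∧
      (l μ₀).re = 0 ∧
      ∃ d : ℝ, d ≠ 0 ∧ HasDerivAt (fun μ => (l μ).re) d μ₀

end PolyField

open Filter Topology Set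

open scoped Matrix

/-! A quadratic field tangent to the sphere can be written `X(x) = x × A x`, with `A` unique up to a
multiple of the identity (`vec_eq_cross`). A singularity on the sphere is a unit eigenvector of `A`,
and a rotation of the coordinates conjugates `A`. So the task is to bring `A` to a suitable shape by
a rotation that is analytic in the parameter.

Rotate a weak focus `p` to the pole. Trace zero makes the upper 2 × 2 block of `A` symmetric, hence
diagonal after a rotation about the axis: `A` has rows `(b₁, 0, 0)`, `(0, b₂, 0)`, `(u, v, l)` with
`(b₁ - l)(b₂ - l) > 0`. If `u = 0`, the field is reversible under `x ↦ -x`; in the time `ds = x dt`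
the pair `(y, z)` moves linearly and `x² = 1 - y² - z²` becomes the energy relation of an oscillator
in a well, so `p` is a center (`isCenter_of_reversible`). The cases `v = 0` and `b₁ = b₂` reduce to
this one by a further rotation. A weak focus therefore has three distinct eigenvalues, with explicit
eigenvectors that are pairwise non-orthogonal. Let `s` belong to the middle eigenvalue `σ`.

Near `μ₀` the eigenvalue of `p(μ)` is analytic, and the other two are the roots of a quadratic with
positive discriminant, so `s` continues analytically (`exists_analytic_eigenvector`). Gram–Schmidt
applied to `s, p` gives a frame whose third vector is an eigenvector and in which the plane of the
first and third vectors is invariant. This kills exactly the entries absent from the normal form.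
The three inequalities at `μ₀` express `p · s ≠ 0`, `s · w ≠ 0` for the third eigenvector `w`, and
that `σ` is the middle eigenvalue; being open conditions, they persist nearby. -/

/-! ### Oscillators with one degree of freedom -/

theorem exists_periodic_phase {ρ : ℝ → ℝ} (hc : Continuous ρ) (hpos : ∀ x, 0 < ρ x)
    (hper : Function.Periodic ρ (2 * Real.pi)) (θ₀ : ℝ) :
    ∃ (θ : ℝ → ℝ) (T : ℝ), 0 < T ∧ θ 0 = θ₀ ∧ (∀ t, HasDerivAt θ (ρ (θ t)) t) ∧
      ∀ t, θ (t + T) = θ t + 2 * Real.pi := by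
  have hgc : Continuous fun x => (ρ x)⁻¹ := hc.inv₀ fun x => (hpos x).ne'
  have hgp : ∀ x, 0 < (ρ x)⁻¹ := fun x => inv_pos.2 (hpos x)
  have hgper : Function.Periodic (fun x => (ρ x)⁻¹) (2 * Real.pi) := fun x => by
    simp only [hper x]
  have hpi : 0 < 2 * Real.pi := Real.two_pi_pos
  -- `τ φ` is the time needed to reach the phase `φ` from `0`. Its inverse is the solution, and `τ
  -- (2π)` is the time of one turn.
  set τ : ℝ → ℝ := fun φ => ∫ x in (0 : ℝ)..φ, (ρ x)⁻¹ with hτ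
  have hint : ∀ a b, IntervalIntegrable (fun x => (ρ x)⁻¹) MeasureTheory.volume a b :=
    fun a b => hgc.intervalIntegrable a b
  have hder : ∀ φ, HasDerivAt τ (ρ φ)⁻¹ φ := fun φ => hgc.integral_hasStrictDerivAt 0 φ |>.hasDerivAt
  have hmono : StrictMono τ := strictMono_of_deriv_pos fun φ => by
    rw [(hder φ).deriv]; exact hgp φ
  have hcont : Continuous τ := continuous_iff_continuousAt.2 fun φ => (hder φ).continuousAt
  have hsurj : Function.Surjective τ := hcont.surjective
    (hgper.tendsto_atTop_intervalIntegral_of_pos' (hint _ _) hgp hpi)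
    (hgper.tendsto_atBot_intervalIntegral_of_pos' (hint _ _) hgp hpi)
  let e := StrictMono.orderIsoOfSurjective τ hmono hsurj
  have he : ∀ x, τ (e.symm x) = x := fun x => e.apply_symm_apply x
  have hT : ∀ φ, τ (φ + 2 * Real.pi) = τ φ + τ (2 * Real.pi) := fun φ => by
    have h1 := hgper.intervalIntegral_add_eq φ 0
    simp only [hτ]
    rw [← intervalIntegral.integral_add_adjacent_intervals (hint 0 φ) (hint φ _), h1, zero_add]
  refine ⟨fun t => e.symm (t + τ θ₀), τ (2 * Real.pi), ?_, ?_, fun t => ?_, fun t => ?_⟩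
  · have := hmono hpi
    simpa [hτ] using this
  · apply hmono.injective
    simp [he]
  · have h1 : HasDerivAt (fun y => e.symm y) ((ρ (e.symm (t + τ θ₀)))⁻¹)⁻¹ (t + τ θ₀) :=
      HasDerivAt.of_local_left_inverse e.symm.continuous.continuousAt (hder _) (hgp _).ne'
        (Eventually.of_forall he)
    rw [inv_inv] at h1
    simpa using h1.comp_add_const t (τ θ₀)
  · apply hmono.injective
    rw [he, hT, he]
    ring

/-- A continuous function whose derivative has a limit at a point is differentiable there. This
covers the turning points of an oscillation, where the square root in `x = ±√g` is not
differentiable. -/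
theorem hasDerivAt_of_eventually_hasDerivAt_of_ne {f g : ℝ → ℝ} {x : ℝ}
    (f_diff : ∀ᶠ y in 𝓝[≠] x, HasDerivAt f (g y) y) (hf : ContinuousAt f x)
    (hg : ContinuousAt g x) : HasDerivAt f (g x) x := by
  have A : HasDerivWithinAt f (g x) (Ici x) x := by
    have h : ∀ᶠ y in 𝓝[>] x, HasDerivAt f (g y) y :=
      f_diff.filter_mono (nhdsWithin_mono _ fun y hy => ne_of_gt hy)
    refine hasDerivWithinAt_Ici_of_tendsto_deriv (s := {y | HasDerivAt f (g y) y})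
      (fun y hy => HasDerivAt.differentiableAt hy |>.differentiableWithinAt)
      hf.continuousWithinAt h ?_
    have : Tendsto g (𝓝[>] x) (𝓝 (g x)) := tendsto_inf_left hg
    exact this.congr' (h.mono fun y hy => hy.deriv.symm)
  have B : HasDerivWithinAt f (g x) (Iic x) x := by
    have h : ∀ᶠ y in 𝓝[<] x, HasDerivAt f (g y) y :=
      f_diff.filter_mono (nhdsWithin_mono _ fun y hy => ne_of_lt hy)
    refine hasDerivWithinAt_Iic_of_tendsto_deriv (s := {y | HasDerivAt f (g y) y})
      (fun y hy => HasDerivAt.differentiableAt hy |>.differentiableWithinAt)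
      hf.continuousWithinAt h ?_
    have : Tendsto g (𝓝[<] x) (𝓝 (g x)) := tendsto_inf_left hg
    exact this.congr' (h.mono fun y hy => hy.deriv.symm)
  simpa using B.union A

/-- Oscillation of `s'' = h(s)` between two consecutive simple zeros `α < β` of its squared
velocity `g`, where `g' = 2 h`. -/
theorem exists_periodic_newton_between {g h : ℝ → ℝ} (hg : ∀ s, HasDerivAt g (2 * h s) s)
    (hh : Continuous h) {α β : ℝ} (hαβ : α < β) (hgα : g α = 0) (hgβ : g β = 0)
    (hpos : ∀ s ∈ Ioo α β, 0 < g s) (hα : 0 < h α) (hβ : h β < 0) {s₀ x₀ : ℝ}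
    (hs₀ : s₀ ∈ Icc α β) (hx₀ : x₀ ^ 2 = g s₀) :
    ∃ (s x : ℝ → ℝ) (T : ℝ), 0 < T ∧ s 0 = s₀ ∧ x 0 = x₀ ∧ (∀ t, HasDerivAt s (x t) t) ∧
      (∀ t, HasDerivAt x (h (s t)) t) ∧ (∀ t, s (t + T) = s t) ∧ ∀ t, x (t + T) = x t := by
  -- `r` is `g` divided by `(s - α)(β - s)`. The slopes extend it continuously over both zeros, and
  -- simplicity of the zeros makes it positive on all of `[α, β]`.
  set r : ℝ → ℝ := fun s => -dslope (dslope g α) β s with hr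
  have hgcont : Continuous g := continuous_iff_continuousAt.2 fun s => (hg s).continuousAt
  have hd1 : ∀ s, s ≠ α → DifferentiableAt ℝ (dslope g α) s := fun s hs =>
    (differentiableAt_dslope_of_ne hs).2 (hg s).differentiableAt
  have hc1 : ∀ s, ContinuousAt (dslope g α) s := fun s => by
    rcases eq_or_ne s α with rfl | hs
    · exact continuousAt_dslope_same.2 (hg s).differentiableAt
    · exact (hd1 s hs).continuousAt
  have hrc : Continuous r := by
    refine Continuous.neg (continuous_iff_continuousAt.2 fun s => ?_)
    rcases eq_or_ne s β with rfl | hs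
    · exact continuousAt_dslope_same.2 (hd1 s hαβ.ne')
    · exact (continuousAt_dslope_of_ne hs).2 (hc1 s)
  have hD1 : ∀ s, (s - α) * dslope g α s = g s := fun s => by
    have := sub_smul_dslope g α s
    simpa [hgα] using this
  have hDβ : dslope g α β = 0 := by
    have := hD1 β
    rw [hgβ] at this
    exact (mul_eq_zero.1 this).resolve_left (sub_ne_zero.2 hαβ.ne')
  have hfac : ∀ s, (s - α) * (β - s) * r s = g s := fun s => by
    have := sub_smul_dslope (dslope g α) β s
    rw [hDβ, sub_zero, smul_eq_mul] at this
    rw [← hD1 s, ← this, hr]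
    ring
  have hrα : r α * (β - α) = 2 * h α := by
    have := sub_smul_dslope (dslope g α) β α
    rw [hDβ, sub_zero, smul_eq_mul, dslope_same, (hg α).deriv] at this
    rw [← this, hr]
    ring
  have hrβ : r β * (β - α) = -(2 * h β) := by
    have h1 : HasDerivAt (dslope g α) (deriv (dslope g α) β) β := (hd1 β hαβ.ne').hasDerivAt
    have h2 : HasDerivAt (fun s => (s - α) * dslope g α s) (2 * h β) β := by
      have : (fun s => (s - α) * dslope g α s) = g := funext hD1
      rw [this]; exact hg β
    have h3 := ((hasDerivAt_id β).sub_const α).mul h1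
    have h4 := h2.unique h3
    simp only [id, hDβ] at h4
    rw [h4]
    simp only [hr, dslope_same]
    ring
  have hrpos : ∀ s ∈ Icc α β, 0 < r s := fun s hs => by
    rcases eq_or_lt_of_le hs.1 with rfl | h1
    · exact pos_of_mul_pos_left (by rw [hrα]; linarith) (sub_pos.2 hαβ).le
    rcases eq_or_lt_of_le hs.2 with rfl | h2
    · exact pos_of_mul_pos_left (by rw [hrβ]; linarith) (sub_pos.2 hαβ).le
    have := hpos s ⟨h1, h2⟩
    rw [← hfac s] at this
    exact pos_of_mul_pos_right this (mul_pos (sub_pos.2 h1) (sub_pos.2 h2)).le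
  -- Midpoint and half-length: with `s = m + R sin φ` the energy relation `s'² = g(s)` becomes `φ'²
  -- = r`, so the phase equation `φ' = √r` has no equilibrium and the turning points are
  -- regularised.
  obtain ⟨m, R, hR, rfl, rfl⟩ : ∃ m R, 0 < R ∧ α = m - R ∧ β = m + R :=
    ⟨(α + β) / 2, (β - α) / 2, by linarith, by ring, by ring⟩
  have hmem : ∀ φ, m + R * Real.sin φ ∈ Icc (m - R) (m + R) := fun φ =>
    ⟨by nlinarith [Real.neg_one_le_sin φ], by nlinarith [Real.sin_le_one φ]⟩
  set ρ : ℝ → ℝ := fun φ => √(r (m + R * Real.sin φ)) with hρ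
  have hρpos : ∀ φ, 0 < ρ φ := fun φ => Real.sqrt_pos.2 (hrpos _ (hmem φ))
  have hρc : Continuous ρ := by
    have : Continuous fun φ => m + R * Real.sin φ := by fun_prop
    exact (hrc.comp this).sqrt
  have hρsq : ∀ φ, ρ φ ^ 2 = r (m + R * Real.sin φ) := fun φ =>
    Real.sq_sqrt (hrpos _ (hmem φ)).le
  have hρper : Function.Periodic ρ (2 * Real.pi) := fun φ => by
    simp only [hρ, Real.sin_add_two_pi]
  have hen : ∀ φ, (R * Real.cos φ * ρ φ) ^ 2 = g (m + R * Real.sin φ) := fun φ => by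
    rw [← hfac, mul_pow, hρsq]
    linear_combination R ^ 2 * r (m + R * Real.sin φ) * Real.sin_sq_add_cos_sq φ
  -- The position fixes the phase up to `a ↔ π - a`; the sign of the velocity `x₀` chooses between
  -- the two.
  obtain ⟨θ₀, hθs, hθx⟩ : ∃ θ₀, m + R * Real.sin θ₀ = s₀ ∧ R * Real.cos θ₀ * ρ θ₀ = x₀ := by
    have hle : -1 ≤ (s₀ - m) / R ∧ (s₀ - m) / R ≤ 1 := by
      rw [le_div_iff₀ hR, div_le_iff₀ hR]
      constructor <;> linarith [hs₀.1, hs₀.2]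
    set a := Real.arcsin ((s₀ - m) / R) with ha
    have hsin : m + R * Real.sin a = s₀ := by
      rw [ha, Real.sin_arcsin hle.1 hle.2]; field_simp; ring
    have h1 := hen a
    rw [hsin, ← hx₀] at h1
    rcases sq_eq_sq_iff_eq_or_eq_neg.1 h1 with h1 | h1
    · exact ⟨a, hsin, h1⟩
    · refine ⟨Real.pi - a, by rw [Real.sin_pi_sub, hsin], ?_⟩
      have : ρ (Real.pi - a) = ρ a := by simp only [hρ, Real.sin_pi_sub]
      rw [this, Real.cos_pi_sub]
      linarith
  obtain ⟨θ, T, hT, hθ0, hθd, hθT⟩ := exists_periodic_phase hρc hρpos hρper θ₀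
  have hθc : Continuous θ := continuous_iff_continuousAt.2 fun t => (hθd t).continuousAt
  have hsd : ∀ t, HasDerivAt (fun t => m + R * Real.sin (θ t))
      (R * Real.cos (θ t) * ρ (θ t)) t := fun t => by
    have := (((hθd t).sin).const_mul R).const_add m
    exact this.congr_deriv (by ring)
  have hsc : Continuous fun t => m + R * Real.sin (θ t) :=
    continuous_iff_continuousAt.2 fun t => (hsd t).continuousAt
  have hxc : Continuous fun t => R * Real.cos (θ t) * ρ (θ t) := by
    have := hρc.comp hθc
    exact ((continuous_const.mul (Real.continuous_cos.comp hθc))).mul this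
  have hxd : ∀ t, R * Real.cos (θ t) * ρ (θ t) ≠ 0 →
      HasDerivAt (fun t => R * Real.cos (θ t) * ρ (θ t)) (h (m + R * Real.sin (θ t))) t := by
    intro t ht
    have hgd := (hg (m + R * Real.sin (θ t))).comp t (hsd t)
    have hne : g (m + R * Real.sin (θ t)) ≠ 0 := by
      rw [← hen]; exact pow_ne_zero 2 ht
    have hsq := hgd.sqrt hne
    simp only [Function.comp_apply] at hsq
    rcases lt_or_gt_of_ne ht with hlt | hgt
    · have hev : ∀ᶠ y in 𝓝 t, R * Real.cos (θ y) * ρ (θ y) < 0 :=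
        hxc.continuousAt.eventually (gt_mem_nhds hlt)
      refine (hsq.neg.congr_of_eventuallyEq (hev.mono fun y hy => ?_)).congr_deriv ?_
      · simp only [Pi.neg_apply, ← hen, Real.sqrt_sq_eq_abs, abs_of_neg hy,
          neg_neg]
      · rw [← hen, Real.sqrt_sq_eq_abs, abs_of_neg hlt]
        generalize R * Real.cos (θ t) * ρ (θ t) = w at hlt
        have := hlt.ne
        field_simp
    · have hev : ∀ᶠ y in 𝓝 t, 0 < R * Real.cos (θ y) * ρ (θ y) :=
        hxc.continuousAt.eventually (lt_mem_nhds hgt)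
      refine (hsq.congr_of_eventuallyEq (hev.mono fun y hy => ?_)).congr_deriv ?_
      · simp only [← hen, Real.sqrt_sq_eq_abs, abs_of_pos hy]
      · rw [← hen, Real.sqrt_sq_eq_abs, abs_of_pos hgt]
        generalize R * Real.cos (θ t) * ρ (θ t) = w at hgt
        field_simp
  refine ⟨fun t => m + R * Real.sin (θ t), fun t => R * Real.cos (θ t) * ρ (θ t), T, hT,
    by simp only [hθ0, hθs], by simp only [hθ0, hθx], hsd, fun t => ?_, fun t => ?_, fun t => ?_⟩
  -- The zeros of `cos θ` are isolated in time because `sin θ` and the phase speed are nonzero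
  -- there, so the equation extends to them by continuity.
  · by_cases ht : R * Real.cos (θ t) * ρ (θ t) = 0
    · have hcos : Real.cos (θ t) = 0 := by
        have := (hρpos (θ t)).ne'
        have := hR.ne'
        simp_all
      have hsin : Real.sin (θ t) ≠ 0 := fun h0 => by
        have := Real.sin_sq_add_cos_sq (θ t)
        rw [h0, hcos] at this
        norm_num at this
      have hne : ∀ᶠ y in 𝓝[≠] t, Real.cos (θ y) ≠ 0 :=
        (hθd t).cos.eventually_ne (mul_ne_zero (neg_ne_zero.2 hsin) (hρpos _).ne')
      exact hasDerivAt_of_eventually_hasDerivAt_of_ne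
        (g := fun t => h (m + R * Real.sin (θ t)))
        (hne.mono fun y hy => hxd y (mul_ne_zero (mul_ne_zero hR.ne' hy) (hρpos _).ne'))
        hxc.continuousAt (hh.comp hsc).continuousAt
    · exact hxd t ht
  · simp only [hθT, Real.sin_add_two_pi]
  · simp only [hθT, Real.cos_add_two_pi, hρper (θ t)]

/-- Oscillation of `s'' = h(s)` in a potential well: `g` is the squared velocity as a function of
the position, strictly concave on `[-δ, δ]`. -/
theorem exists_periodic_newton {g h D : ℝ → ℝ} (hg : ∀ s, HasDerivAt g (2 * h s) s)
    (hh : ∀ s, HasDerivAt h (D s) s) {δ : ℝ} (hδ : 0 < δ) (hD : ∀ s ∈ Icc (-δ) δ, D s < 0)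
    (hgδ : g δ < 0) (hgδ' : g (-δ) < 0) {x₀ : ℝ} (hx₀ : x₀ ^ 2 = g 0)
    (hne : ¬ (x₀ = 0 ∧ h 0 = 0)) :
    ∃ (s x : ℝ → ℝ) (T : ℝ), 0 < T ∧ s 0 = 0 ∧ x 0 = x₀ ∧ (∀ t, HasDerivAt s (x t) t) ∧
      (∀ t, HasDerivAt x (h (s t)) t) ∧ (∀ t, s (t + T) = s t) ∧ ∀ t, x (t + T) = x t := by
  have hgc : Continuous g := continuous_iff_continuousAt.2 fun s => (hg s).continuousAt
  have hhc : Continuous h := continuous_iff_continuousAt.2 fun s => (hh s).continuousAt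
  have hanti : StrictAntiOn h (Icc (-δ) δ) :=
    strictAntiOn_of_deriv_neg (convex_Icc _ _) hhc.continuousOn fun s hs => by
      rw [interior_Icc] at hs
      rw [(hh s).deriv]; exact hD s (Ioo_subset_Icc_self hs)
  have hconc : StrictConcaveOn ℝ (Icc (-δ) δ) g := by
    refine StrictAntiOn.strictConcaveOn_of_deriv (convex_Icc _ _) hgc.continuousOn ?_
    rw [interior_Icc]
    intro a ha b hb hab
    rw [(hg a).deriv, (hg b).deriv]
    linarith [hanti (Ioo_subset_Icc_self ha) (Ioo_subset_Icc_self hb) hab]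
  have hbet : ∀ a ∈ Icc (-δ) δ, ∀ b ∈ Icc (-δ) δ, 0 ≤ g a → 0 ≤ g b → ∀ s, a < s → s < b →
      0 < g s := by
    intro a ha b hb hga hgb s h1 h2
    have hba : 0 < b - a := by linarith
    have h3 := hconc.2 ha hb (by linarith : a ≠ b) (div_pos (sub_pos.2 h2) hba)
      (div_pos (sub_pos.2 h1) hba) (by field_simp; ring)
    have h4 : ((b - s) / (b - a)) • a + ((s - a) / (b - a)) • b = s := by
      simp only [smul_eq_mul]; field_simp; ring
    rw [h4] at h3
    refine lt_of_le_of_lt ?_ h3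
    have := div_pos (sub_pos.2 h2) hba
    have := div_pos (sub_pos.2 h1) hba
    simp only [smul_eq_mul]
    positivity
  have hg0 : 0 ≤ g 0 := hx₀ ▸ sq_nonneg x₀
  have h0mem : (0 : ℝ) ∈ Icc (-δ) δ := ⟨by linarith, hδ.le⟩
  -- Otherwise `0` is a local maximum of `g` with value `0`, so `x₀ = 0` and `h 0 = 0`: the excluded
  -- equilibrium.
  obtain ⟨c, hc, hgcpos⟩ : ∃ c ∈ Ioo (-δ) δ, 0 < g c := by
    by_contra! hcon
    have h0 : (0 : ℝ) ∈ Ioo (-δ) δ := ⟨by linarith, hδ⟩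
    have hgz : g 0 = 0 := le_antisymm (hcon 0 h0) hg0
    have hloc : IsLocalMax g 0 := by
      filter_upwards [isOpen_Ioo.mem_nhds h0] with s hs
      rw [hgz]; exact hcon s hs
    have h1 := hloc.hasDerivAt_eq_zero (hg 0)
    refine hne ⟨?_, by linarith⟩
    rw [hgz] at hx₀
    exact pow_eq_zero_iff (two_ne_zero) |>.1 hx₀
  have hcI : c ∈ Icc (-δ) δ := Ioo_subset_Icc_self hc
  obtain ⟨α, hα, hgα⟩ := intermediate_value_Ioo hc.1.le hgc.continuousOn ⟨hgδ', hgcpos⟩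
  obtain ⟨β, hβ, hgβ⟩ := intermediate_value_Ioo' hc.2.le hgc.continuousOn ⟨hgδ, hgcpos⟩
  have hαI : α ∈ Icc (-δ) δ := ⟨hα.1.le, by linarith [hα.2, hc.2]⟩
  have hβI : β ∈ Icc (-δ) δ := ⟨by linarith [hβ.1, hc.1], hβ.2.le⟩
  -- By concavity `g` is positive strictly between `0` and `c`, so no zero of `g` lies there; hence
  -- `0 ∈ [α, β]`.
  have hα0 : α ≤ 0 := by
    by_contra! hlt
    linarith [hbet 0 h0mem c hcI hg0 hgcpos.le α hlt hα.2]
  have hβ0 : 0 ≤ β := by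
    by_contra! hlt
    linarith [hbet c hcI 0 h0mem hgcpos.le hg0 β hβ.1 hlt]
  have hhα : 0 < h α := by
    obtain ⟨ξ, hξ, hξ'⟩ := exists_hasDerivAt_eq_slope g (fun s => 2 * h s) hα.2
      hgc.continuousOn fun s _ => hg s
    have : 0 < 2 * h ξ := by
      rw [hξ', hgα, sub_zero]; exact div_pos hgcpos (sub_pos.2 hα.2)
    have := hanti hαI ⟨by linarith [hαI.1, hξ.1], by linarith [hcI.2, hξ.2]⟩ hξ.1
    linarith
  have hhβ : h β < 0 := by
    obtain ⟨ξ, hξ, hξ'⟩ := exists_hasDerivAt_eq_slope g (fun s => 2 * h s) hβ.1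
      hgc.continuousOn fun s _ => hg s
    have : 2 * h ξ < 0 := by
      rw [hξ', hgβ, zero_sub]; exact div_neg_of_neg_of_pos (neg_neg_of_pos hgcpos) (sub_pos.2 hβ.1)
    have := hanti ⟨by linarith [hcI.1, hξ.1], by linarith [hβI.2, hξ.2]⟩ hβI hξ.2
    linarith
  exact exists_periodic_newton_between hg hhc (hα.2.trans hβ.1) hgα hgβ
    (fun s hs => hbet α hαI β hβI hgα.ge hgβ.ge s hs.1 hs.2) hhα hhβ ⟨hα0, hβ0⟩ hx₀

/-! ### Centers of reversible quadratic fields -/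

theorem exists_linear_flow (L : (ℝ × ℝ) →L[ℝ] (ℝ × ℝ)) :
    ∃ Φ : ℝ → ℝ × ℝ → ℝ × ℝ, (∀ w, Φ 0 w = w) ∧ (∀ s w, HasDerivAt (fun s => Φ s w) (L (Φ s w)) s) ∧
      Continuous fun x : ℝ × (ℝ × ℝ) => Φ x.1 x.2 := by
  refine ⟨fun s w => NormedSpace.exp (s • L) w, fun w => by simp, fun s w => ?_, ?_⟩
  · have h := (hasDerivAt_exp_smul_const' (𝕂 := ℝ) L s).clm_apply (hasDerivAt_const s w)
    simpa using h
  · have h1 : Continuous fun x : ℝ × (ℝ × ℝ) => NormedSpace.exp (x.1 • L) := by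
      let _ : NormedAlgebra ℚ ((ℝ × ℝ) →L[ℝ] (ℝ × ℝ)) := NormedAlgebra.restrictScalars ℚ ℝ _
      exact NormedSpace.exp_continuous.comp (continuous_fst.smul continuous_const)
    exact h1.clm_apply continuous_snd

/-- The field is reversible under `x ↦ -x`; along its orbits `(y, z)` follows, in a new time `s`,
a planar linear flow. -/
theorem reversible_field_periodic_orbits {k₁ k₂ v : ℝ} (hk : 0 < k₁ * k₂) :
    ∃ U ∈ 𝓝 (![0, 0, 1] : Fin 3 → ℝ), ∀ q ∈ U ∩ unitSphere2, q ≠ ![0, 0, 1] →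
      ∃ (c : ℝ → Fin 3 → ℝ) (T : ℝ),
        (∀ t, HasDerivAt c ![c t 1 * (v * c t 1 - k₂ * c t 2), c t 0 * (k₁ * c t 2 - v * c t 1),
          (k₂ - k₁) * c t 0 * c t 1] t) ∧ c 0 = q ∧ 0 < T ∧
        (∀ t, c (t + T) = c t) ∧ ∃ t, c t ≠ q := by
  have hk₁ : k₁ ≠ 0 := left_ne_zero_of_mul hk.ne'
  have hk₂ : k₂ ≠ 0 := right_ne_zero_of_mul hk.ne'
  let f₁ : (ℝ × ℝ) →L[ℝ] ℝ := k₁ • ContinuousLinearMap.snd ℝ ℝ ℝ - v • ContinuousLinearMap.fst ℝ ℝ ℝ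
  let f₂ : (ℝ × ℝ) →L[ℝ] ℝ := (k₂ - k₁) • ContinuousLinearMap.fst ℝ ℝ ℝ
  obtain ⟨Φ, hΦ0, hΦd, hΦc⟩ := exists_linear_flow (f₁.prod f₂)
  have hY : ∀ s w, HasDerivAt (fun s => (Φ s w).1) (k₁ * (Φ s w).2 - v * (Φ s w).1) s := fun s w => by
    exact ((ContinuousLinearMap.fst ℝ ℝ ℝ).hasFDerivAt.comp_hasDerivAt s (hΦd s w)).congr_deriv
      (by simp [f₁])
  have hZ : ∀ s w, HasDerivAt (fun s => (Φ s w).2) ((k₂ - k₁) * (Φ s w).1) s := fun s w => by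
    exact ((ContinuousLinearMap.snd ℝ ℝ ℝ).hasFDerivAt.comp_hasDerivAt s (hΦd s w)).congr_deriv
      (by simp [f₂])
  -- With `s' = x`, `G` is `x²` on the sphere, `H` is `x'`, and `D` is the derivative of `H` along
  -- the linear flow. At the pole `D = -k₁k₂ < 0`, which is where the sign hypothesis makes the well
  -- strictly concave.
  set G : ℝ × ℝ → ℝ := fun w => 1 - w.1 ^ 2 - w.2 ^ 2 with hG
  set H : ℝ × ℝ → ℝ := fun w => w.1 * (v * w.1 - k₂ * w.2) with hH
  set D : ℝ × ℝ → ℝ := fun w => (k₁ * w.2 - v * w.1) * (2 * v * w.1 - k₂ * w.2)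
    - k₂ * (k₂ - k₁) * w.1 ^ 2 with hDdef
  have hGc : Continuous G := by fun_prop
  have hDc : Continuous D := by fun_prop
  have hg : ∀ w s, HasDerivAt (fun s => G (Φ s w)) (2 * H (Φ s w)) s := fun w s => by
    have := (((hY s w).fun_pow 2).const_sub 1).fun_sub ((hZ s w).fun_pow 2)
    refine this.congr_deriv ?_
    simp only [hH]
    push_cast
    ring
  have hh : ∀ w s, HasDerivAt (fun s => H (Φ s w)) (D (Φ s w)) s := fun w s => by
    have := (hY s w).fun_mul (((hY s w).const_mul v).fun_sub ((hZ s w).const_mul k₂))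
    refine this.congr_deriv ?_
    simp only [hDdef]
    ring
  -- a neighbourhood where the well is strictly concave
  have hDneg : ∀ᶠ x : ℝ × (ℝ × ℝ) in 𝓝 (0, (0, 1)), D (Φ x.1 x.2) < 0 := by
    refine (hDc.comp hΦc).continuousAt.eventually (gt_mem_nhds ?_)
    simp only [Function.comp_apply, hΦ0, hDdef]
    nlinarith
  rw [nhds_prod_eq] at hDneg
  obtain ⟨P, hP, Q, hQ, hPQ⟩ := eventually_prod_iff.1 hDneg
  obtain ⟨δ, hδ, hδP⟩ := Metric.eventually_nhds_iff.1 hP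
  have hδ2 : 0 < δ / 2 := by linarith
  have hD : ∀ s ∈ Icc (-(δ / 2)) (δ / 2), ∀ w, Q w → D (Φ s w) < 0 := fun s hs w hw => by
    refine hPQ (hδP ?_) hw
    rw [Real.dist_eq, sub_zero, abs_lt]
    constructor <;> linarith [hs.1, hs.2]
  have hQ1 : Q (0, 1) := hQ.self_of_nhds
  -- For the orbit of the pole, `G` and its derivative vanish at `s = 0`, so strict concavity makes
  -- `G` negative elsewhere. Negativity at the two ends `±δ/2` then persists for nearby initial
  -- points.
  have hwell : ∀ s ∈ Icc (-(δ / 2)) (δ / 2), s ≠ 0 → G (Φ s (0, 1)) < 0 := by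
    have hgc : Continuous fun s => G (Φ s (0, 1)) :=
      continuous_iff_continuousAt.2 fun s => (hg _ s).continuousAt
    have hhc : Continuous fun s => H (Φ s (0, 1)) :=
      continuous_iff_continuousAt.2 fun s => (hh _ s).continuousAt
    have hanti : StrictAntiOn (fun s => H (Φ s (0, 1))) (Icc (-(δ / 2)) (δ / 2)) :=
      strictAntiOn_of_deriv_neg (convex_Icc _ _) hhc.continuousOn fun s hs => by
        rw [interior_Icc] at hs
        rw [(hh _ s).deriv]; exact hD s (Ioo_subset_Icc_self hs) _ hQ1
    have h0 : H (Φ 0 (0, 1)) = 0 := by simp [hΦ0, hH]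
    have h0' : G (Φ 0 (0, 1)) = 0 := by simp [hΦ0, hG]
    intro s hs hs0
    have h0mem : (0 : ℝ) ∈ Icc (-(δ / 2)) (δ / 2) := ⟨by linarith, hδ2.le⟩
    rcases lt_or_gt_of_ne hs0 with hlt | hgt
    · obtain ⟨ξ, hξ, hξ'⟩ := exists_hasDerivAt_eq_slope (fun s => G (Φ s (0, 1)))
        (fun s => 2 * H (Φ s (0, 1))) hlt hgc.continuousOn fun s _ => hg _ s
      have h1 : H (Φ 0 (0, 1)) < H (Φ ξ (0, 1)) :=
        hanti ⟨by linarith [hs.1, hξ.1], by linarith [hξ.2]⟩ h0mem hξ.2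
      rw [h0', eq_div_iff (by linarith)] at hξ'
      nlinarith
    · obtain ⟨ξ, hξ, hξ'⟩ := exists_hasDerivAt_eq_slope (fun s => G (Φ s (0, 1)))
        (fun s => 2 * H (Φ s (0, 1))) hgt hgc.continuousOn fun s _ => hg _ s
      have h1 : H (Φ ξ (0, 1)) < H (Φ 0 (0, 1)) :=
        hanti h0mem ⟨by linarith [hξ.1], by linarith [hs.2, hξ.2]⟩ hξ.1
      rw [h0', eq_div_iff (by linarith)] at hξ'
      nlinarith
  have hGev : ∀ s ∈ Icc (-(δ / 2)) (δ / 2), s ≠ 0 → ∀ᶠ w in 𝓝 ((0, 1) : ℝ × ℝ), G (Φ s w) < 0 :=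
    fun s hs hs0 => by
      have : Continuous fun w => G (Φ s w) :=
        hGc.comp (hΦc.comp (continuous_const.prodMk continuous_id))
      exact this.continuousAt.eventually (gt_mem_nhds (hwell s hs hs0))
  have hev1 := hGev (δ / 2) ⟨by linarith, le_rfl⟩ hδ2.ne'
  have hev2 := hGev (-(δ / 2)) ⟨le_rfl, by linarith⟩ (by linarith)
  have hev3 : ∀ᶠ w in 𝓝 ((0, 1) : ℝ × ℝ), v * w.1 - k₂ * w.2 ≠ 0 := by
    have : Continuous fun w : ℝ × ℝ => v * w.1 - k₂ * w.2 := by fun_prop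
    exact this.continuousAt.eventually_ne (by simpa using hk₂)
  have hev4 : ∀ᶠ w in 𝓝 ((0, 1) : ℝ × ℝ), 0 < w.2 :=
    continuous_snd.continuousAt.eventually (lt_mem_nhds (by simp))
  have hev5 : ∀ᶠ w in 𝓝 ((0, 1) : ℝ × ℝ), k₁ * w.2 - v * w.1 ≠ 0 := by
    have : Continuous fun w : ℝ × ℝ => k₁ * w.2 - v * w.1 := by fun_prop
    exact this.continuousAt.eventually_ne (by simpa using hk₁)
  have hproj : Tendsto (fun q : Fin 3 → ℝ => (q 1, q 2)) (𝓝 ![0, 0, 1]) (𝓝 (0, 1)) := by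
    have : Continuous fun q : Fin 3 → ℝ => (q 1, q 2) := by fun_prop
    simpa using this.tendsto ![0, 0, 1]
  refine ⟨_, hproj (hQ.and (hev1.and (hev2.and (hev3.and (hev4.and hev5))))), ?_⟩
  rintro q ⟨⟨hq, h1, h2, h3, h4, h5⟩, hqs⟩ hqne
  simp only at h3 h4 h5
  have hqs' : q 0 ^ 2 + q 1 ^ 2 + q 2 ^ 2 = 1 := hqs
  -- The starting point of the oscillator is not an equilibrium: with `q 2 > 0`, that would force
  -- `q` to be the pole itself.
  have hdeg : ¬ (q 0 = 0 ∧ H (Φ 0 (q 1, q 2)) = 0) := by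
    rintro ⟨ha, hb⟩
    rw [hΦ0] at hb
    have hq1 : q 1 = 0 := (mul_eq_zero.1 hb).resolve_right h3
    have hq2 : q 2 = 1 := by
      rw [ha, hq1] at hqs'
      nlinarith
    exact hqne (by ext i; fin_cases i <;> simp [ha, hq1, hq2])
  obtain ⟨s, x, T, hT, hs0, hx0, hsd, hxd, hsT, hxT⟩ :=
    exists_periodic_newton (hg (q 1, q 2)) (hh (q 1, q 2)) hδ2
      (fun s hs => hD s hs _ hq) h1 h2 (x₀ := q 0) (by simp only [hΦ0, hG]; linarith) hdeg
  have hcd : ∀ t, HasDerivAt (fun t => (![x t, (Φ (s t) (q 1, q 2)).1, (Φ (s t) (q 1, q 2)).2] : Fin 3 → ℝ))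
      ![(Φ (s t) (q 1, q 2)).1 * (v * (Φ (s t) (q 1, q 2)).1 - k₂ * (Φ (s t) (q 1, q 2)).2),
        x t * (k₁ * (Φ (s t) (q 1, q 2)).2 - v * (Φ (s t) (q 1, q 2)).1),
        (k₂ - k₁) * x t * (Φ (s t) (q 1, q 2)).1] t := fun t => by
    rw [hasDerivAt_pi]
    intro i
    fin_cases i
    · exact hxd t
    · exact ((hY (s t) _).comp t (hsd t)).congr_deriv (by simp; ring)
    · exact ((hZ (s t) _).comp t (hsd t)).congr_deriv (by simp; ring)
  have hc0 : (![x 0, (Φ (s 0) (q 1, q 2)).1, (Φ (s 0) (q 1, q 2)).2] : Fin 3 → ℝ) = q := by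
    ext i; fin_cases i <;> simp [hs0, hx0, hΦ0]
  refine ⟨_, T, hcd, hc0, hT, fun t => by simp only [hsT, hxT], ?_⟩
  by_contra! hcon
  have hconst : (fun t => (![x t, (Φ (s t) (q 1, q 2)).1, (Φ (s t) (q 1, q 2)).2] : Fin 3 → ℝ))
      = fun _ => q := funext hcon
  have hz := hcd 0
  rw [hconst] at hz
  have hz' := (hasDerivAt_const (0 : ℝ) q).unique hz
  have e0 := congrFun hz' 0
  have e1 := congrFun hz' 1
  simp only [hs0, hx0, hΦ0] at e0 e1
  refine hdeg ⟨(mul_eq_zero.1 (by simpa using e1.symm)).resolve_right h5, ?_⟩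
  rw [hΦ0]
  simpa [hH] using e0.symm

/-! ### Quadratic forms and the cross-product representation -/

theorem Finsupp.degree_two_cases (d : Fin 3 →₀ ℕ) (hd : d.degree = 2) :
    ∃ i j : Fin 3, i ≤ j ∧ d = Finsupp.single i 1 + Finsupp.single j 1 := by
  have h : d 0 + d 1 + d 2 = 2 := by
    rw [Finsupp.degree_eq_sum, Fin.sum_univ_three] at hd
    exact hd
  have key : ∀ i j : Fin 3, i ≤ j →
      (∀ k, d k = (Finsupp.single i 1 + Finsupp.single j 1 : Fin 3 →₀ ℕ) k) →
      ∃ i j : Fin 3, i ≤ j ∧ d = Finsupp.single i 1 + Finsupp.single j 1 :=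
    fun i j hij hk => ⟨i, j, hij, Finsupp.ext hk⟩
  have hcases : (d 0 = 2 ∧ d 1 = 0 ∧ d 2 = 0) ∨ (d 0 = 1 ∧ d 1 = 1 ∧ d 2 = 0) ∨
      (d 0 = 1 ∧ d 1 = 0 ∧ d 2 = 1) ∨ (d 0 = 0 ∧ d 1 = 2 ∧ d 2 = 0) ∨
      (d 0 = 0 ∧ d 1 = 1 ∧ d 2 = 1) ∨ (d 0 = 0 ∧ d 1 = 0 ∧ d 2 = 2) := by omega
  rcases hcases with ⟨h0, h1, h2⟩ | ⟨h0, h1, h2⟩ | ⟨h0, h1, h2⟩ | ⟨h0, h1, h2⟩ | ⟨h0, h1, h2⟩ |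
    ⟨h0, h1, h2⟩
  · exact key 0 0 (by decide) fun k => by fin_cases k <;> simp [h0, h1, h2]
  · exact key 0 1 (by decide) fun k => by fin_cases k <;> simp [h0, h1, h2]
  · exact key 0 2 (by decide) fun k => by fin_cases k <;> simp [h0, h1, h2]
  · exact key 1 1 (by decide) fun k => by fin_cases k <;> simp [h0, h1, h2]
  · exact key 1 2 (by decide) fun k => by fin_cases k <;> simp [h0, h1, h2]
  · exact key 2 2 (by decide) fun k => by fin_cases k <;> simp [h0, h1, h2]

/-- The coefficient of `xᵢ xⱼ`. -/
noncomputable def MvPolynomial.quadCoeff (f : MvPolynomial (Fin 3) ℝ) (i j : Fin 3) : ℝ :=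
  f.coeff (Finsupp.single i 1 + Finsupp.single j 1)

theorem MvPolynomial.IsHomogeneous.eval_eq_quadratic {f : MvPolynomial (Fin 3) ℝ}
    (hf : f.IsHomogeneous 2) (x : Fin 3 → ℝ) :
    MvPolynomial.eval x f = f.quadCoeff 0 0 * x 0 ^ 2 + f.quadCoeff 0 1 * (x 0 * x 1)
      + f.quadCoeff 0 2 * (x 0 * x 2) + f.quadCoeff 1 1 * x 1 ^ 2
      + f.quadCoeff 1 2 * (x 1 * x 2) + f.quadCoeff 2 2 * x 2 ^ 2 := by
  classical
  set e : Fin 3 × Fin 3 → (Fin 3 →₀ ℕ) := fun p => Finsupp.single p.1 1 + Finsupp.single p.2 1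
  set I : Finset (Fin 3 × Fin 3) := {(0, 0), (0, 1), (0, 2), (1, 1), (1, 2), (2, 2)} with hI
  have hsub : f.support ⊆ I.image e := fun d hd => by
    have hdeg : d.degree = 2 := by
      have := hf (MvPolynomial.mem_support_iff.1 hd)
      rwa [Finsupp.degree_eq_weight_one]
    obtain ⟨i, j, hij, rfl⟩ := Finsupp.degree_two_cases d hdeg
    refine Finset.mem_image.2 ⟨(i, j), ?_, rfl⟩
    clear hd hdeg
    revert i j
    decide
  have hinj : Set.InjOn e I := by
    intro p hp q hq hpq
    have h0 := DFunLike.congr_fun hpq 0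
    have h1 := DFunLike.congr_fun hpq 1
    have h2 := DFunLike.congr_fun hpq 2
    simp only [e, Finsupp.add_apply, Finsupp.single_apply] at h0 h1 h2
    revert h0 h1 h2 hp hq; clear hpq
    simp only [hI, Finset.mem_coe]
    revert p q
    decide
  rw [MvPolynomial.eval_eq', Finset.sum_subset hsub fun d _ hd => by
    rw [MvPolynomial.notMem_support_iff.1 hd, zero_mul], Finset.sum_image hinj]
  simp [hI, e, MvPolynomial.quadCoeff, Fin.prod_univ_three, Finsupp.single_apply, pow_succ]
  ring

section

open MvPolynomial

/-- Polarisation of a quadratic form; it turns the Jacobian into differences of values, to which the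
cross-product formula applies. -/
theorem MvPolynomial.IsHomogeneous.sum_pderiv_mul {f : MvPolynomial (Fin 3) ℝ}
    (hf : f.IsHomogeneous 2) (p w : Fin 3 → ℝ) :
    ∑ j, MvPolynomial.eval p (MvPolynomial.pderiv j f) * w j =
      MvPolynomial.eval (p + w) f - MvPolynomial.eval p f - MvPolynomial.eval w f := by
  have hexp : f = C (f.quadCoeff 0 0) * X 0 ^ 2 + C (f.quadCoeff 0 1) * (X 0 * X 1)
      + C (f.quadCoeff 0 2) * (X 0 * X 2) + C (f.quadCoeff 1 1) * X 1 ^ 2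
      + C (f.quadCoeff 1 2) * (X 1 * X 2) + C (f.quadCoeff 2 2) * X 2 ^ 2 :=
    MvPolynomial.funext fun x => by simp [hf.eval_eq_quadratic x]
  have h01 : pderiv 0 (X 1 : MvPolynomial (Fin 3) ℝ) = 0 := pderiv_X_of_ne (by decide)
  have h02 : pderiv 0 (X 2 : MvPolynomial (Fin 3) ℝ) = 0 := pderiv_X_of_ne (by decide)
  have h10 : pderiv 1 (X 0 : MvPolynomial (Fin 3) ℝ) = 0 := pderiv_X_of_ne (by decide)
  have h12 : pderiv 1 (X 2 : MvPolynomial (Fin 3) ℝ) = 0 := pderiv_X_of_ne (by decide)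
  have h20 : pderiv 2 (X 0 : MvPolynomial (Fin 3) ℝ) = 0 := pderiv_X_of_ne (by decide)
  have h21 : pderiv 2 (X 1 : MvPolynomial (Fin 3) ℝ) = 0 := pderiv_X_of_ne (by decide)
  simp only [hf.eval_eq_quadratic, Fin.sum_univ_three, Pi.add_apply]
  generalize hc00 : f.quadCoeff 0 0 = c00 at *
  generalize hc01 : f.quadCoeff 0 1 = c01 at *
  generalize hc02 : f.quadCoeff 0 2 = c02 at *
  generalize hc11 : f.quadCoeff 1 1 = c11 at *
  generalize hc12 : f.quadCoeff 1 2 = c12 at *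
  generalize hc22 : f.quadCoeff 2 2 = c22 at *
  rw [hexp]
  simp only [map_add, Derivation.leibniz, Derivation.leibniz_pow, pderiv_C, pderiv_X_self, h01, h02,
    h10, h12, h20, h21, smul_eq_mul, map_mul, map_pow, eval_C, eval_X, map_zero, map_one,
    nsmul_eq_mul, map_natCast]
  push_cast
  ring

end

namespace PolyField

/-- The matrix `A` with `X(x) = x × A x` whose lower right entry is zero. -/
noncomputable def crossMatrix (X : PolyField) : Matrix (Fin 3) (Fin 3) ℝ :=
  !![(X 1).quadCoeff 0 2, (X 1).quadCoeff 1 2, (X 1).quadCoeff 2 2;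
     -(X 0).quadCoeff 0 2, -(X 0).quadCoeff 1 2, -(X 0).quadCoeff 2 2;
     (X 0).quadCoeff 0 1, (X 0).quadCoeff 1 1, 0]

theorem IsQuadraticOnSphere.dot_vec_eq_zero {X : PolyField} (hX : X.IsQuadraticOnSphere)
    (x : Fin 3 → ℝ) : x 0 * X.vec x 0 + x 1 * X.vec x 1 + x 2 * X.vec x 2 = 0 := by
  by_cases hx : x 0 ^ 2 + x 1 ^ 2 + x 2 ^ 2 = 0
  · have h0 : x 0 = 0 := by nlinarith [sq_nonneg (x 0), sq_nonneg (x 1), sq_nonneg (x 2)]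
    have h1 : x 1 = 0 := by nlinarith [sq_nonneg (x 0), sq_nonneg (x 1), sq_nonneg (x 2)]
    have h2 : x 2 = 0 := by nlinarith [sq_nonneg (x 0), sq_nonneg (x 1), sq_nonneg (x 2)]
    simp [h0, h1, h2]
  · have hpos : 0 < x 0 ^ 2 + x 1 ^ 2 + x 2 ^ 2 := lt_of_le_of_ne (by positivity) (Ne.symm hx)
    set n := √(x 0 ^ 2 + x 1 ^ 2 + x 2 ^ 2) with hn
    have hn0 : n ≠ 0 := (Real.sqrt_pos.2 hpos).ne'
    have hnsq : n ^ 2 = x 0 ^ 2 + x 1 ^ 2 + x 2 ^ 2 := Real.sq_sqrt hpos.le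
    have hy := hX.2 (n⁻¹ • x) (by
      simp only [unitSphere2, Set.mem_ofPred_eq, Pi.smul_apply, smul_eq_mul, mul_pow, ← mul_add]
      rw [← hnsq]; field_simp)
    have hvec : ∀ i, X.vec (n⁻¹ • x) i = (n⁻¹) ^ 2 * X.vec x i := fun i => by
      simp only [vec, (hX.1 i).eval_eq_quadratic, Pi.smul_apply, smul_eq_mul]
      ring
    simp only [hvec, Pi.smul_apply, smul_eq_mul] at hy
    have h3 : (n⁻¹) ^ 3 * (x 0 * X.vec x 0 + x 1 * X.vec x 1 + x 2 * X.vec x 2) = 0 := by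
      linear_combination hy
    exact (mul_eq_zero.1 h3).resolve_left (pow_ne_zero 3 (inv_ne_zero hn0))

theorem IsQuadraticOnSphere.vec_eq_cross {X : PolyField} (hX : X.IsQuadraticOnSphere)
    (x : Fin 3 → ℝ) : X.vec x = crossProduct x (X.crossMatrix *ᵥ x) := by
  have key : ∀ a b c : ℝ, _ := fun a b c => hX.dot_vec_eq_zero ![a, b, c]
  simp only [vec, (hX.1 _).eval_eq_quadratic, Matrix.cons_val_zero, Matrix.cons_val_one,
    Matrix.cons_val] at key
  -- The cubic form `x · X(x)` vanishes identically. These ten values determine its ten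
  -- coefficients, and their vanishing gives the linear relations between the coefficients of the
  -- components.
  have k1 := key 1 0 0
  have k2 := key 0 1 0
  have k3 := key 0 0 1
  have k4 := key 1 1 0
  have k5 := key 1 (-1) 0
  have k6 := key 1 0 1
  have k7 := key 1 0 (-1)
  have k8 := key 0 1 1
  have k9 := key 0 1 (-1)
  have k10 := key 1 1 1
  ring_nf at k1 k2 k3 k4 k5 k6 k7 k8 k9 k10
  rw [cross_apply]
  ext i
  simp only [vec, (hX.1 _).eval_eq_quadratic, crossMatrix, Matrix.mulVec, dotProduct,
    Fin.sum_univ_three]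
  generalize x 0 = a
  generalize x 1 = b
  generalize x 2 = c
  have e1 : (X 1).quadCoeff 0 0 = -(X 0).quadCoeff 0 1 := by linarith
  have e2 : (X 1).quadCoeff 0 1 = -(X 0).quadCoeff 1 1 := by linarith
  have e3 : (X 2).quadCoeff 0 0 = -(X 0).quadCoeff 0 2 := by linarith
  have e4 : (X 2).quadCoeff 0 2 = -(X 0).quadCoeff 2 2 := by linarith
  have e5 : (X 2).quadCoeff 1 1 = -(X 1).quadCoeff 1 2 := by linarith
  have e6 : (X 2).quadCoeff 1 2 = -(X 1).quadCoeff 2 2 := by linarith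
  have e7 : (X 2).quadCoeff 0 1 = -(X 0).quadCoeff 1 2 - (X 1).quadCoeff 0 2 := by linarith
  fin_cases i <;> simp [e1, e2, e3, e4, e5, e6, e7, k1, k2, k3] <;> ring

theorem IsQuadraticOnSphere.jacobian_mulVec {X : PolyField} (hX : X.IsQuadraticOnSphere)
    (p w : Fin 3 → ℝ) : X.jacobian p *ᵥ w =
      crossProduct p (X.crossMatrix *ᵥ w) + crossProduct w (X.crossMatrix *ᵥ p) := by
  have h : X.jacobian p *ᵥ w = X.vec (p + w) - X.vec p - X.vec w := funext fun i =>
    (hX.1 i).sum_pderiv_mul p w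
  rw [h, hX.vec_eq_cross, hX.vec_eq_cross, hX.vec_eq_cross, Matrix.mulVec_add]
  simp only [map_add, LinearMap.add_apply]
  abel

end PolyField

/-! ### Rotations and orthonormal frames -/

/-- Rotation matrices of `ℝ³`. -/
def Matrix.IsRotation (R : Matrix (Fin 3) (Fin 3) ℝ) : Prop :=
  R * Rᵀ = 1 ∧ R.det = 1

namespace Matrix.IsRotation

variable {R S : Matrix (Fin 3) (Fin 3) ℝ}

theorem transpose_mul_self (hR : R.IsRotation) : Rᵀ * R = 1 :=
  mul_eq_one_comm.1 hR.1

theorem mul (hR : R.IsRotation) (hS : S.IsRotation) : (R * S).IsRotation := by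
  refine ⟨?_, by rw [det_mul, hR.2, hS.2, one_mul]⟩
  rw [transpose_mul, Matrix.mul_assoc, ← Matrix.mul_assoc S, hS.1, Matrix.one_mul, hR.1]

theorem transpose (hR : R.IsRotation) : Rᵀ.IsRotation :=
  ⟨by rw [transpose_transpose, hR.transpose_mul_self], by rw [det_transpose, hR.2]⟩

theorem mem_orthogonalGroup (hR : R.IsRotation) : R ∈ Matrix.orthogonalGroup (Fin 3) ℝ := by
  rw [Matrix.mem_orthogonalGroup_iff]
  exact hR.1

theorem transpose_mulVec_mulVec (hR : R.IsRotation) (x : Fin 3 → ℝ) : Rᵀ *ᵥ (R *ᵥ x) = x := by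
  rw [mulVec_mulVec, hR.transpose_mul_self, one_mulVec]

theorem mulVec_transpose_mulVec (hR : R.IsRotation) (x : Fin 3 → ℝ) : R *ᵥ (Rᵀ *ᵥ x) = x := by
  rw [mulVec_mulVec, hR.1, one_mulVec]

theorem dotProduct_mulVec_mulVec (hR : R.IsRotation) (x y : Fin 3 → ℝ) :
    (R *ᵥ x) ⬝ᵥ (R *ᵥ y) = x ⬝ᵥ y := by
  rw [dotProduct_mulVec, vecMul_mulVec, hR.transpose_mul_self, vecMul_one]

/-- The adjugate of a rotation is its transpose, so each entry equals its own cofactor; these are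
the coordinate identities needed. -/
theorem mulVec_cross (hR : R.IsRotation) (a b : Fin 3 → ℝ) :
    R *ᵥ crossProduct a b = crossProduct (R *ᵥ a) (R *ᵥ b) := by
  have hadj : R.adjugate = Rᵀ := by
    have h : R * R.adjugate = 1 := by rw [mul_adjugate, hR.2, one_smul]
    calc R.adjugate = Rᵀ * (R * R.adjugate) := by
          rw [← Matrix.mul_assoc, hR.transpose_mul_self, Matrix.one_mul]
      _ = Rᵀ := by rw [h, Matrix.mul_one]
  rw [adjugate_fin_three] at hadj
  have h : ∀ i j, _ = Rᵀ i j := fun i j => congrFun (congrFun hadj i) j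
  have h00 := h 0 0
  have h01 := h 0 1
  have h02 := h 0 2
  have h10 := h 1 0
  have h11 := h 1 1
  have h12 := h 1 2
  have h20 := h 2 0
  have h21 := h 2 1
  have h22 := h 2 2
  simp at h00 h01 h02 h10 h11 h12 h20 h21 h22
  rw [cross_apply, cross_apply]
  ext i
  fin_cases i <;> simp [mulVec, dotProduct, Fin.sum_univ_three]
  · rw [← h00, ← h10, ← h20]; ring
  · rw [← h01, ← h11, ← h21]; ring
  · rw [← h02, ← h12, ← h22]; ring

theorem mulVec_cross_mulVec (hR : R.IsRotation) (A : Matrix (Fin 3) (Fin 3) ℝ) (x : Fin 3 → ℝ) :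
    R *ᵥ crossProduct x (A *ᵥ x) = crossProduct (R *ᵥ x) ((R * A * Rᵀ) *ᵥ (R *ᵥ x)) := by
  rw [hR.mulVec_cross, mulVec_mulVec, mulVec_mulVec, Matrix.mul_assoc, hR.transpose_mul_self,
    Matrix.mul_one]

theorem conj_mulVec (hR : R.IsRotation) {A : Matrix (Fin 3) (Fin 3) ℝ} {x : Fin 3 → ℝ} {l : ℝ}
    (h : A *ᵥ x = l • x) : (R * A * Rᵀ) *ᵥ (R *ᵥ x) = l • (R *ᵥ x) := by
  rw [mulVec_mulVec, Matrix.mul_assoc, hR.transpose_mul_self, Matrix.mul_one, ← mulVec_mulVec, h,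
    mulVec_smul]

theorem mulVec_of_conj (hR : R.IsRotation) {A : Matrix (Fin 3) (Fin 3) ℝ} {x : Fin 3 → ℝ} {l : ℝ}
    (h : (R * A * Rᵀ) *ᵥ x = l • x) : A *ᵥ (Rᵀ *ᵥ x) = l • (Rᵀ *ᵥ x) := by
  have := hR.transpose.conj_mulVec h
  rwa [transpose_transpose, Matrix.mul_assoc, Matrix.mul_assoc, hR.transpose_mul_self,
    Matrix.mul_one, ← Matrix.mul_assoc, hR.transpose_mul_self, Matrix.one_mul] at this

end Matrix.IsRotation

/-- The matrix whose rows are the orthonormal frame `a, b × a, b`. -/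
def frameMatrix (a b : Fin 3 → ℝ) : Matrix (Fin 3) (Fin 3) ℝ :=
  Matrix.of ![a, crossProduct b a, b]

theorem frameMatrix_isRotation {a b : Fin 3 → ℝ} (ha : a ⬝ᵥ a = 1) (hb : b ⬝ᵥ b = 1)
    (hab : a ⬝ᵥ b = 0) : (frameMatrix a b).IsRotation := by
  simp only [dotProduct, Fin.sum_univ_three] at ha hb hab
  have hcc : (b 1 * a 2 - b 2 * a 1) ^ 2 + (b 2 * a 0 - b 0 * a 2) ^ 2
      + (b 0 * a 1 - b 1 * a 0) ^ 2 = 1 := by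
    linear_combination (b 0 ^ 2 + b 1 ^ 2 + b 2 ^ 2) * ha + hb
      - (a 0 * b 0 + a 1 * b 1 + a 2 * b 2) * hab
  constructor
  · ext i j
    rw [Matrix.mul_apply, Fin.sum_univ_three]
    fin_cases i <;> fin_cases j <;> simp [frameMatrix, cross_apply]
    · linear_combination ha
    · ring
    · linear_combination hab
    · ring
    · linear_combination hcc
    · ring
    · linear_combination hab
    · ring
    · linear_combination hb
  · rw [Matrix.det_fin_three]
    simp [frameMatrix, cross_apply]
    linear_combination hcc

/-- Rotation about the third axis. -/
def axisRotation (c s : ℝ) : Matrix (Fin 3) (Fin 3) ℝ :=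
  !![c, s, 0; -s, c, 0; 0, 0, 1]

theorem axisRotation_isRotation {c s : ℝ} (h : c ^ 2 + s ^ 2 = 1) :
    (axisRotation c s).IsRotation := by
  constructor
  · ext i j
    rw [Matrix.mul_apply, Fin.sum_univ_three]
    fin_cases i <;> fin_cases j <;> simp [axisRotation] <;>
      first | ring1 | linear_combination h
  · rw [Matrix.det_fin_three]
    simp [axisRotation]
    linear_combination h

theorem axisRotation_conj (c s b₁ b b₂ u v l : ℝ) :
    axisRotation c s * !![b₁, b, 0; b, b₂, 0; u, v, l] * (axisRotation c s)ᵀ =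
      !![c ^ 2 * b₁ + 2 * (c * s) * b + s ^ 2 * b₂, (c ^ 2 - s ^ 2) * b + c * s * (b₂ - b₁), 0;
        (c ^ 2 - s ^ 2) * b + c * s * (b₂ - b₁), s ^ 2 * b₁ - 2 * (c * s) * b + c ^ 2 * b₂, 0;
        c * u + s * v, c * v - s * u, l] := by
  ext i j
  rw [Matrix.mul_apply, Fin.sum_univ_three]
  simp only [Matrix.mul_apply, Fin.sum_univ_three]
  fin_cases i <;> fin_cases j <;> simp [axisRotation] <;> ring

theorem axisRotation_mulVec_pole (c s : ℝ) : axisRotation c s *ᵥ ![0, 0, 1] = ![0, 0, 1] := by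
  ext i
  fin_cases i <;> simp [axisRotation, Matrix.mulVec, dotProduct, Fin.sum_univ_three]

theorem exists_rotation_to_pole {p : Fin 3 → ℝ} (hp : p ⬝ᵥ p = 1) :
    ∃ R : Matrix (Fin 3) (Fin 3) ℝ, R.IsRotation ∧ R *ᵥ p = ![0, 0, 1] := by
  have main : ∀ a : Fin 3 → ℝ, a ⬝ᵥ a = 1 → a ⬝ᵥ p = 0 →
      ∃ R : Matrix (Fin 3) (Fin 3) ℝ, R.IsRotation ∧ R *ᵥ p = ![0, 0, 1] := fun a ha hap => by
    refine ⟨frameMatrix a p, frameMatrix_isRotation ha hp hap, ?_⟩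
    simp only [dotProduct, Fin.sum_univ_three] at hp hap
    ext i
    fin_cases i <;> simp [frameMatrix, cross_apply, Matrix.mulVec, dotProduct, Fin.sum_univ_three]
    · exact hap
    · ring
    · exact hp
  by_cases h : p 0 ^ 2 + p 1 ^ 2 = 0
  · have h0 : p 0 = 0 := by nlinarith [sq_nonneg (p 0), sq_nonneg (p 1)]
    refine main ![1, 0, 0] (by simp) (by simp [dotProduct, Fin.sum_univ_three, h0])
  · have hpos : 0 < p 0 ^ 2 + p 1 ^ 2 := lt_of_le_of_ne (by positivity) (Ne.symm h)
    have hn0 := (Real.sqrt_pos.2 hpos).ne'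
    have hnsq := Real.sq_sqrt hpos.le
    set n := √(p 0 ^ 2 + p 1 ^ 2)
    refine main ![-p 1 / n, p 0 / n, 0] ?_ ?_
    · simp [dotProduct, Fin.sum_univ_three]
      field_simp
      linarith
    · simp [dotProduct, Fin.sum_univ_three]
      field_simp
      ring

theorem Matrix.IsRotation.mulVec_mem_unitSphere2 {R : Matrix (Fin 3) (Fin 3) ℝ} (hR : R.IsRotation)
    {x : Fin 3 → ℝ} (hx : x ∈ unitSphere2) : R *ᵥ x ∈ unitSphere2 := by
  have h := hR.dotProduct_mulVec_mulVec x x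
  have hx' : x 0 ^ 2 + x 1 ^ 2 + x 2 ^ 2 = 1 := hx
  simp only [dotProduct, Fin.sum_univ_three] at h
  change (R *ᵥ x) 0 ^ 2 + (R *ᵥ x) 1 ^ 2 + (R *ᵥ x) 2 ^ 2 = 1
  linear_combination h + hx'

/-! ### Linear part at a singularity, and eigenvectors at a weak focus -/

namespace PolyField

/-- In the rotated coordinates the field is the reversible one with `kᵢ = bᵢ - l`; its periodic
orbits around the pole are carried back by `Rᵀ`. -/
theorem IsQuadraticOnSphere.isCenter_of_reversible {X : PolyField} (hX : X.IsQuadraticOnSphere)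
    {p : Fin 3 → ℝ} (hp : X.IsSingularity p) {R : Matrix (Fin 3) (Fin 3) ℝ} (hR : R.IsRotation)
    (hRp : R *ᵥ p = ![0, 0, 1]) {b₁ b₂ v l : ℝ}
    (hA : R * X.crossMatrix * Rᵀ = !![b₁, 0, 0; 0, b₂, 0; 0, v, l])
    (hpos : 0 < (b₁ - l) * (b₂ - l)) : X.IsCenter p := by
  refine ⟨hp, ?_⟩
  obtain ⟨U, hU, hUq⟩ := reversible_field_periodic_orbits (v := v) hpos
  have hRc : Continuous fun x : Fin 3 → ℝ => R *ᵥ x := by fun_prop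
  refine ⟨(fun x => R *ᵥ x) ⁻¹' U, hRc.continuousAt.preimage_mem_nhds (by rwa [hRp]), ?_⟩
  rintro q ⟨hqU, hqs⟩ hqp
  obtain ⟨c, T, hc, hc0, hT, hcT, t, ht⟩ := hUq (R *ᵥ q) ⟨hqU, hR.mulVec_mem_unitSphere2 hqs⟩
    fun h => hqp (by rw [← hR.transpose_mulVec_mulVec q, h, ← hRp, hR.transpose_mulVec_mulVec])
  refine ⟨fun t => Rᵀ *ᵥ c t, T, fun t => ?_, ?_, hT, fun t => ?_, t, fun h => ht ?_⟩
  · have h1 := (Rᵀ.mulVecLin.toContinuousLinearMap.hasFDerivAt).comp_hasDerivAt t (hc t)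
    refine h1.congr_deriv ?_
    rw [hX.vec_eq_cross, ← hR.transpose_mulVec_mulVec (crossProduct _ _), hR.mulVec_cross_mulVec,
      hR.mulVec_transpose_mulVec, hA]
    simp only [LinearMap.coe_toContinuousLinearMap', Matrix.mulVecLin_apply]
    congr 1
    rw [cross_apply]
    ext i
    fin_cases i <;> simp [Matrix.mulVec, dotProduct, Fin.sum_univ_three] <;> ring
  · simp only [hc0, hR.transpose_mulVec_mulVec]
  · simp only [hcT]
  · rw [← h, hR.mulVec_transpose_mulVec]

theorem IsQuadraticOnSphere.crossMatrix_mulVec_singularity {X : PolyField}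
    (hX : X.IsQuadraticOnSphere) {p : Fin 3 → ℝ} (hp : X.IsSingularity p) :
    p ⬝ᵥ p = 1 ∧ X.crossMatrix *ᵥ p = (p ⬝ᵥ X.crossMatrix *ᵥ p) • p := by
  have h1 : p 0 ^ 2 + p 1 ^ 2 + p 2 ^ 2 = 1 := hp.1
  have h2 := hp.2
  rw [hX.vec_eq_cross, cross_apply] at h2
  refine ⟨by simp only [dotProduct, Fin.sum_univ_three]; linear_combination h1, ?_⟩
  generalize X.crossMatrix *ᵥ p = y at *
  have e0 := congrFun h2 0
  have e1 := congrFun h2 1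
  have e2 := congrFun h2 2
  simp at e0 e1 e2
  ext i
  -- Coordinates of `p × (p × y) = (p · y) p - (p · p) y`, whose left side vanishes.
  fin_cases i <;> simp [dotProduct, Fin.sum_univ_three]
  · linear_combination -y 0 * h1 + p 2 * e1 - p 1 * e2
  · linear_combination -y 1 * h1 - p 2 * e0 + p 0 * e2
  · linear_combination -y 2 * h1 + p 1 * e0 - p 0 * e1

/-- A planar linear map exchanging, up to the factor `ω`, two vectors that are not both zero
has trace zero and determinant `ω²`. -/
theorem trace_eq_zero_det_eq_of_rotation {n₁ n₂ n₃ n₄ ω a₀ a₁ b₀ b₁ : ℝ} (hω : 0 < ω)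
    (h₁ : n₁ * a₀ + n₂ * a₁ = -(ω * b₀)) (h₂ : n₃ * a₀ + n₄ * a₁ = -(ω * b₁))
    (h₃ : n₁ * b₀ + n₂ * b₁ = ω * a₀) (h₄ : n₃ * b₀ + n₄ * b₁ = ω * a₁)
    (hne : ¬ (a₀ = 0 ∧ a₁ = 0 ∧ b₀ = 0 ∧ b₁ = 0)) :
    n₁ + n₄ = 0 ∧ n₁ * n₄ - n₂ * n₃ = ω ^ 2 := by
  set t := n₁ + n₄ with ht
  set e := n₁ * n₄ - n₂ * n₃ - ω ^ 2 with he
  -- Cayley–Hamilton, `N² - tN + det N = 0`, applied to `a` and `b` with `N a = -ω b` and `N b = ω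
  -- a`. Together the relations show that `(tω)² + e²` annihilates both vectors.
  have k1 : -(t * ω * b₀) = e * a₀ := by
    rw [ht, he]; linear_combination -n₄ * h₁ + n₂ * h₂ - ω * h₃
  have k2 : -(t * ω * b₁) = e * a₁ := by
    rw [ht, he]; linear_combination -n₁ * h₂ + n₃ * h₁ - ω * h₄
  have k3 : t * ω * a₀ = e * b₀ := by
    rw [ht, he]; linear_combination -n₄ * h₃ + n₂ * h₄ + ω * h₁
  have k4 : t * ω * a₁ = e * b₁ := by
    rw [ht, he]; linear_combination -n₁ * h₄ + n₃ * h₃ + ω * h₂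
  have m1 : ((t * ω) ^ 2 + e ^ 2) * a₀ = 0 := by linear_combination t * ω * k3 - e * k1
  have m2 : ((t * ω) ^ 2 + e ^ 2) * a₁ = 0 := by linear_combination t * ω * k4 - e * k2
  have m3 : ((t * ω) ^ 2 + e ^ 2) * b₀ = 0 := by linear_combination -(t * ω * k1) - e * k3
  have m4 : ((t * ω) ^ 2 + e ^ 2) * b₁ = 0 := by linear_combination -(t * ω * k2) - e * k4
  have hz : (t * ω) ^ 2 + e ^ 2 = 0 := by
    by_contra hz
    exact hne ⟨(mul_eq_zero.1 m1).resolve_left hz, (mul_eq_zero.1 m2).resolve_left hz,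
      (mul_eq_zero.1 m3).resolve_left hz, (mul_eq_zero.1 m4).resolve_left hz⟩
  have h5 : t * ω = 0 := by nlinarith [sq_nonneg (t * ω), sq_nonneg e]
  have h6 : e = 0 := by nlinarith [sq_nonneg (t * ω), sq_nonneg e]
  exact ⟨(mul_eq_zero.1 h5).resolve_right hω.ne', by linarith⟩

theorem IsTangentEigenvalue.exists_real_pair {X : PolyField} {p : Fin 3 → ℝ} {ω : ℝ}
    (h : X.IsTangentEigenvalue p ((ω : ℂ) * Complex.I)) :
    ∃ a b : Fin 3 → ℝ, ¬ (a = 0 ∧ b = 0) ∧ p ⬝ᵥ a = 0 ∧ p ⬝ᵥ b = 0 ∧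
      X.jacobian p *ᵥ a = -(ω • b) ∧ X.jacobian p *ᵥ b = ω • a := by
  obtain ⟨w, hw, hpw, hJ⟩ := h
  refine ⟨fun i => (w i).re, fun i => (w i).im, fun h0 => hw ?_, ?_, ?_, ?_, ?_⟩
  · ext i
    exact Complex.ext (congrFun h0.1 i) (congrFun h0.2 i)
  · simpa [dotProduct, Fin.sum_univ_three] using congrArg Complex.re hpw
  · simpa [dotProduct, Fin.sum_univ_three] using congrArg Complex.im hpw
  · ext i
    have := congrArg Complex.re (congrFun hJ i)
    simpa [Matrix.mulVec, dotProduct, Fin.sum_univ_three] using this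
  · ext i
    have := congrArg Complex.im (congrFun hJ i)
    simpa [Matrix.mulVec, dotProduct, Fin.sum_univ_three] using this

/-- The principal axes are at half the argument of `(b₁ - b₂) + 2b i`. -/
theorem exists_rotation_diagonalizing (b₁ b b₂ : ℝ) :
    ∃ c s : ℝ, c ^ 2 + s ^ 2 = 1 ∧ (c ^ 2 - s ^ 2) * b + c * s * (b₂ - b₁) = 0 := by
  set z : ℂ := ⟨b₁ - b₂, 2 * b⟩ with hz
  have h1 : ‖z‖ * Real.cos z.arg = b₁ - b₂ := Complex.norm_mul_cos_arg z
  have h2 : ‖z‖ * Real.sin z.arg = 2 * b := Complex.norm_mul_sin_arg z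
  refine ⟨Real.cos (z.arg / 2), Real.sin (z.arg / 2), Real.cos_sq_add_sin_sq _, ?_⟩
  have h3 : Real.cos z.arg = Real.cos (z.arg / 2) ^ 2 - Real.sin (z.arg / 2) ^ 2 := by
    rw [← Real.cos_two_mul']; ring_nf
  have h4 : Real.sin z.arg = 2 * Real.sin (z.arg / 2) * Real.cos (z.arg / 2) := by
    rw [← Real.sin_two_mul]; ring_nf
  rw [h3] at h1
  rw [h4] at h2
  linear_combination -(Real.cos (z.arg / 2) ^ 2 - Real.sin (z.arg / 2) ^ 2) / 2 * h2
    + Real.cos (z.arg / 2) * Real.sin (z.arg / 2) * h1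

/-- With `p` at the pole, the tangent linear part is a quarter turn composed with the upper block of
the matrix minus `l`. Its trace is the antisymmetric part of the block and its determinant is that
of the block minus `l`. Eigenvalues `±iω` thus make the block symmetric with determinant `ω² > 0`
after the shift. -/
theorem IsQuadraticOnSphere.exists_rotation_of_tangentEigenvalue {X : PolyField}
    (hX : X.IsQuadraticOnSphere) {p : Fin 3 → ℝ} (hp : X.IsSingularity p) {ω : ℝ} (hω : 0 < ω)
    (h : X.IsTangentEigenvalue p ((ω : ℂ) * Complex.I)) :
    ∃ (R : Matrix (Fin 3) (Fin 3) ℝ) (b₁ b₂ u v l : ℝ), R.IsRotation ∧ R *ᵥ p = ![0, 0, 1] ∧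
      R * X.crossMatrix * Rᵀ = !![b₁, 0, 0; 0, b₂, 0; u, v, l] ∧ 0 < (b₁ - l) * (b₂ - l) := by
  obtain ⟨hpp, hAp⟩ := hX.crossMatrix_mulVec_singularity hp
  obtain ⟨R, hR, hRp⟩ := exists_rotation_to_pole hpp
  obtain ⟨a, b, hab, hpa, hpb, hJa, hJb⟩ := h.exists_real_pair
  generalize p ⬝ᵥ X.crossMatrix *ᵥ p = l at hAp
  have hconj : ∀ w, R *ᵥ (X.jacobian p *ᵥ w) =
      crossProduct ![0, 0, 1] ((R * X.crossMatrix * Rᵀ) *ᵥ (R *ᵥ w)) +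
      crossProduct (R *ᵥ w) (l • ![0, 0, 1]) := fun w => by
    rw [hX.jacobian_mulVec, Matrix.mulVec_add, hR.mulVec_cross, hR.mulVec_cross, hAp,
      Matrix.mulVec_smul, hRp, Matrix.mulVec_mulVec, Matrix.mulVec_mulVec, Matrix.mul_assoc,
      hR.transpose_mul_self, Matrix.mul_one]
  have hBp := hR.conj_mulVec hAp
  rw [hRp] at hBp
  have hca := hconj a
  have hcb := hconj b
  rw [hJa, Matrix.mulVec_neg, Matrix.mulVec_smul] at hca
  rw [hJb, Matrix.mulVec_smul] at hcb
  have ha2 : (R *ᵥ a) 2 = 0 := by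
    have := hR.dotProduct_mulVec_mulVec p a
    rw [hRp, hpa] at this
    simpa [dotProduct, Fin.sum_univ_three] using this
  have hb2 : (R *ᵥ b) 2 = 0 := by
    have := hR.dotProduct_mulVec_mulVec p b
    rw [hRp, hpb] at this
    simpa [dotProduct, Fin.sum_univ_three] using this
  have hab' : ¬ (R *ᵥ a = 0 ∧ R *ᵥ b = 0) := fun h0 => hab
    ⟨by rw [← hR.transpose_mulVec_mulVec a, h0.1, Matrix.mulVec_zero],
      by rw [← hR.transpose_mulVec_mulVec b, h0.2, Matrix.mulVec_zero]⟩
  generalize hB : R * X.crossMatrix * Rᵀ = B at *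
  generalize R *ᵥ a = a' at *
  generalize R *ᵥ b = b' at *
  have p0 := congrFun hBp 0
  have p1 := congrFun hBp 1
  have p2 := congrFun hBp 2
  have ca0 := congrFun hca 0
  have ca1 := congrFun hca 1
  have cb0 := congrFun hcb 0
  have cb1 := congrFun hcb 1
  simp only [cross_apply] at ca0 ca1 cb0 cb1
  simp [Matrix.mulVec, dotProduct, Fin.sum_univ_three, ha2, hb2] at p0 p1 p2 ca0 ca1 cb0 cb1
  have hN := trace_eq_zero_det_eq_of_rotation (n₁ := -B 1 0) (n₂ := l - B 1 1) (n₃ := B 0 0 - l)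
    (n₄ := B 0 1) hω (a₀ := a' 0) (a₁ := a' 1) (b₀ := b' 0) (b₁ := b' 1)
    (by linarith) (by linarith) (by linarith) (by linarith)
    (fun ⟨h0, h1, h2, h3⟩ => hab' ⟨by ext i; fin_cases i <;> assumption,
      by ext i; fin_cases i <;> assumption⟩)
  have hsym : B 1 0 = B 0 1 := by linarith [hN.1]
  have hBform : B = !![B 0 0, B 0 1, 0; B 0 1, B 1 1, 0; B 2 0, B 2 1, l] := by
    ext i j
    fin_cases i <;> fin_cases j <;> simp [p0, p1, p2, hsym]
  obtain ⟨c, s, hcs, hdiag⟩ := exists_rotation_diagonalizing (B 0 0) (B 0 1) (B 1 1)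
  have hS := axisRotation_isRotation hcs
  refine ⟨axisRotation c s * R, c ^ 2 * B 0 0 + 2 * (c * s) * B 0 1 + s ^ 2 * B 1 1,
    s ^ 2 * B 0 0 - 2 * (c * s) * B 0 1 + c ^ 2 * B 1 1, c * B 2 0 + s * B 2 1,
    c * B 2 1 - s * B 2 0, l, hS.mul hR, ?_, ?_, ?_⟩
  · rw [← Matrix.mulVec_mulVec, hRp, axisRotation_mulVec_pole]
  · have : axisRotation c s * R * X.crossMatrix * (axisRotation c s * R)ᵀ =
        axisRotation c s * B * (axisRotation c s)ᵀ := by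
      rw [← hB, Matrix.transpose_mul]; simp only [Matrix.mul_assoc]
    conv_lhs => rw [this, hBform, axisRotation_conj, hdiag]
  · have hd := hN.2
    rw [hsym] at hd
    have : (c ^ 2 * B 0 0 + 2 * (c * s) * B 0 1 + s ^ 2 * B 1 1 - l) *
        (s ^ 2 * B 0 0 - 2 * (c * s) * B 0 1 + c ^ 2 * B 1 1 - l) = ω ^ 2 := by
      have hl : l = l * (c ^ 2 + s ^ 2) := by rw [hcs, mul_one]
      have hdet : (c ^ 2 * B 0 0 + 2 * (c * s) * B 0 1 + s ^ 2 * B 1 1 - l * (c ^ 2 + s ^ 2)) *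
        (s ^ 2 * B 0 0 - 2 * (c * s) * B 0 1 + c ^ 2 * B 1 1 - l * (c ^ 2 + s ^ 2)) -
        ((c ^ 2 - s ^ 2) * B 0 1 + c * s * (B 1 1 - B 0 0)) ^ 2 =
        (c ^ 2 + s ^ 2) ^ 2 * ((B 0 0 - l) * (B 1 1 - l) - B 0 1 ^ 2) := by ring
      rw [hdiag, hcs] at hdet
      linear_combination hdet + hd
    rw [this]
    positivity

/-- At a weak focus the matrix has three real eigenvectors: the focus `p`, a saddle `s`, and a third
one `w`, and the saddle is orthogonal to none of the others. -/
theorem IsQuadraticOnSphere.exists_eigenvectors_of_isWeakFocus {X : PolyField}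
    (hX : X.IsQuadraticOnSphere) {p : Fin 3 → ℝ} (hp : X.IsWeakFocus p) :
    ∃ (l σ γ : ℝ) (s w : Fin 3 → ℝ), X.crossMatrix *ᵥ p = l • p ∧ X.crossMatrix *ᵥ s = σ • s ∧
      X.crossMatrix *ᵥ w = γ • w ∧ 0 < (σ - γ) * (l - σ) ∧ p ⬝ᵥ s ≠ 0 ∧ s ⬝ᵥ w ≠ 0 := by
  obtain ⟨hsing, ⟨ω, hω, hev⟩, hnc⟩ := hp
  obtain ⟨R, b₁, b₂, u, v, l, hR, hRp, hA, hpos⟩ :=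
    hX.exists_rotation_of_tangentEigenvalue hsing hω hev
  -- A rotation about the axis that keeps the block diagonal and kills the entry `u` would exhibit
  -- `p` as a reversible center.
  have hno : ¬ ∃ c s : ℝ, c ^ 2 + s ^ 2 = 1 ∧ c * s * (b₂ - b₁) = 0 ∧ c * u + s * v = 0 := by
    rintro ⟨c, s, hcs, h1, h2⟩
    have hS := axisRotation_isRotation hcs
    have hconj : axisRotation c s * R * X.crossMatrix * (axisRotation c s * R)ᵀ =
        axisRotation c s * !![b₁, 0, 0; 0, b₂, 0; u, v, l] * (axisRotation c s)ᵀ := by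
      rw [← hA, Matrix.transpose_mul]; simp only [Matrix.mul_assoc]
    rw [axisRotation_conj, h1, h2] at hconj
    simp only [mul_zero, add_zero, sub_zero] at hconj
    refine hnc (hX.isCenter_of_reversible hsing (hS.mul hR) ?_ hconj ?_)
    · rw [← Matrix.mulVec_mulVec, hRp, axisRotation_mulVec_pole]
    · have : (c ^ 2 * b₁ + s ^ 2 * b₂ - l) * (s ^ 2 * b₁ + c ^ 2 * b₂ - l) =
          (b₁ - l) * (b₂ - l) := by
        have hc2 : c ^ 2 = 1 - s ^ 2 := by linarith
        have h3 : c ^ 2 * s ^ 2 * (b₂ - b₁) ^ 2 = 0 := by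
          linear_combination (c * s * (b₂ - b₁)) * h1
        rw [hc2] at h3 ⊢
        linear_combination h3
      rwa [this]
  have hu : u ≠ 0 := fun h => hno ⟨1, 0, by norm_num, by ring, by rw [h]; ring⟩
  have hv : v ≠ 0 := fun h => hno ⟨0, 1, by norm_num, by ring, by rw [h]; ring⟩
  -- If `b₁ = b₂` the block is scalar, every rotation keeps it diagonal, and one orthogonal to `(u,
  -- v)` kills `u`.
  have hb : b₂ - b₁ ≠ 0 := fun h => by
    have hpos' : 0 < u ^ 2 + v ^ 2 := by positivity
    have hn0 := (Real.sqrt_pos.2 hpos').ne'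
    have hnsq := Real.sq_sqrt hpos'.le
    refine hno ⟨v / √(u ^ 2 + v ^ 2), -u / √(u ^ 2 + v ^ 2), ?_, by rw [h, mul_zero], ?_⟩
    · field_simp; linarith
    · field_simp; ring
  have e1 : (R * X.crossMatrix * Rᵀ) *ᵥ ![b₁ - l, 0, u] = b₁ • ![b₁ - l, 0, u] := by
    rw [hA]; ext i
    fin_cases i <;> simp [Matrix.mulVec, dotProduct, Fin.sum_univ_three] <;> ring
  have e2 : (R * X.crossMatrix * Rᵀ) *ᵥ ![0, b₂ - l, v] = b₂ • ![0, b₂ - l, v] := by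
    rw [hA]; ext i
    fin_cases i <;> simp [Matrix.mulVec, dotProduct, Fin.sum_univ_three] <;> ring
  have e3 : X.crossMatrix *ᵥ p = l • p := by
    have hp' : Rᵀ *ᵥ ![0, 0, 1] = p := by rw [← hRp, hR.transpose_mulVec_mulVec]
    rw [← hp']
    refine hR.mulVec_of_conj ?_
    rw [hA]; ext i
    fin_cases i <;> simp [Matrix.mulVec, dotProduct, Fin.sum_univ_three]
  have hd1 : p ⬝ᵥ (Rᵀ *ᵥ ![b₁ - l, 0, u]) = u := by
    rw [← hR.dotProduct_mulVec_mulVec, hR.mulVec_transpose_mulVec, hRp]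
    simp [dotProduct, Fin.sum_univ_three]
  have hd2 : p ⬝ᵥ (Rᵀ *ᵥ ![0, b₂ - l, v]) = v := by
    rw [← hR.dotProduct_mulVec_mulVec, hR.mulVec_transpose_mulVec, hRp]
    simp [dotProduct, Fin.sum_univ_three]
  have hd3 : (Rᵀ *ᵥ ![b₁ - l, 0, u]) ⬝ᵥ (Rᵀ *ᵥ ![0, b₂ - l, v]) = u * v := by
    rw [hR.transpose.dotProduct_mulVec_mulVec]
    simp [dotProduct, Fin.sum_univ_three]
  -- As `b₁ - l` and `b₂ - l` have the same sign, `l` is extreme among the three eigenvalues; `σ` is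
  -- whichever of `b₁`, `b₂` lies strictly between the others.
  rcases lt_or_ge 0 ((b₁ - b₂) * (l - b₁)) with hlt | hge
  · exact ⟨l, b₁, b₂, _, _, e3, hR.mulVec_of_conj e1, hR.mulVec_of_conj e2, hlt,
      by rwa [hd1], by rw [hd3]; exact mul_ne_zero hu hv⟩
  · refine ⟨l, b₂, b₁, _, _, e3, hR.mulVec_of_conj e2, hR.mulVec_of_conj e1, ?_, by rwa [hd2], ?_⟩
    · have hsq : 0 < (b₂ - b₁) ^ 2 := by positivity
      by_contra! hcon
      rcases mul_pos_iff.1 hpos with ⟨h1, h2⟩ | ⟨h1, h2⟩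
      · nlinarith
      · nlinarith
    · rw [dotProduct_comm, hd3]; exact mul_ne_zero hu hv

end PolyField

/-! ### Analytic dependence of eigenvectors -/

theorem AnalyticAt.real_sqrt {f : ℝ → ℝ} {x : ℝ} (hf : AnalyticAt ℝ f x) (h : f x ≠ 0) :
    AnalyticAt ℝ (fun y => √(f y)) x :=
  AnalyticAt.fun_comp (g := Real.sqrt) (Real.contDiffAt_sqrt h).analyticAt hf

/-- The sum of the principal `2 × 2` minors. -/
def Matrix.secondInvariant (A : Matrix (Fin 3) (Fin 3) ℝ) : ℝ :=
  A 0 0 * A 1 1 - A 0 1 * A 1 0 + (A 0 0 * A 2 2 - A 0 2 * A 2 0)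
    + (A 1 1 * A 2 2 - A 1 2 * A 2 1)

theorem Matrix.charpoly_eq_zero_of_mulVec_eq {A : Matrix (Fin 3) (Fin 3) ℝ} {x : Fin 3 → ℝ}
    (hx : x ≠ 0) {l : ℝ} (h : A *ᵥ x = l • x) :
    l ^ 3 - A.trace * l ^ 2 + A.secondInvariant * l - A.det = 0 := by
  have hdet : (A - l • (1 : Matrix (Fin 3) (Fin 3) ℝ)).det = 0 :=
    Matrix.exists_mulVec_eq_zero_iff.1 ⟨x, hx, by
      rw [Matrix.sub_mulVec, Matrix.smul_mulVec, Matrix.one_mulVec, h, sub_self]⟩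
  rw [Matrix.det_fin_three] at hdet
  simp at hdet
  rw [Matrix.trace_fin_three, Matrix.secondInvariant, Matrix.det_fin_three]
  linear_combination -hdet

/-- Cayley–Hamilton in factored form. With `A - σ` in front, every vector in the range of the other
two factors satisfies the eigenvector equation for `σ`. -/
theorem Matrix.mul_mul_eq_zero_of_charpoly {A : Matrix (Fin 3) (Fin 3) ℝ} {l σ γ : ℝ}
    (h₁ : A.trace = l + σ + γ) (h₂ : A.secondInvariant = l * σ + l * γ + σ * γ)
    (h₃ : A.det = l * σ * γ) :
    (A - σ • (1 : Matrix (Fin 3) (Fin 3) ℝ)) * ((A - l • 1) * (A - γ • 1)) = 0 := by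
  have hch : A * A * A - A.trace • (A * A) + A.secondInvariant • A - A.det • 1 = 0 := by
    ext i j
    simp only [Matrix.sub_apply, Matrix.add_apply, Matrix.smul_apply, Matrix.mul_apply,
      Fin.sum_univ_three, Matrix.trace_fin_three, Matrix.det_fin_three, Matrix.secondInvariant,
      smul_eq_mul, Matrix.zero_apply]
    fin_cases i <;> fin_cases j <;> simp <;> ring
  rw [← hch, h₁, h₂, h₃]
  simp only [sub_mul, mul_sub, Matrix.smul_mul, Matrix.mul_smul, Matrix.one_mul, Matrix.mul_one,
    smul_smul, Matrix.mul_assoc]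
  module

/-- Simple real eigenvalues, and their eigenvectors, depend analytically on the matrix, once
another eigenvalue is known to. -/
theorem exists_analytic_eigenvector {A : ℝ → Matrix (Fin 3) (Fin 3) ℝ} {μ₀ : ℝ}
    (hA : ∀ i j, AnalyticAt ℝ (fun μ => A μ i j) μ₀) {l : ℝ → ℝ} (hl : AnalyticAt ℝ l μ₀)
    {p : ℝ → Fin 3 → ℝ} (hp : ∀ᶠ μ in 𝓝 μ₀, p μ ≠ 0 ∧ A μ *ᵥ p μ = l μ • p μ)
    {σ γ : ℝ} {s w : Fin 3 → ℝ} (hs0 : s ≠ 0) (hs : A μ₀ *ᵥ s = σ • s) (hw0 : w ≠ 0)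
    (hw : A μ₀ *ᵥ w = γ • w) (hσγ : σ ≠ γ) (hlσ : l μ₀ ≠ σ) (hlγ : l μ₀ ≠ γ) :
    ∃ (σ' : ℝ → ℝ) (s' : ℝ → Fin 3 → ℝ), (∀ i, AnalyticAt ℝ (fun μ => s' μ i) μ₀) ∧
      σ' μ₀ = σ ∧ (∃ k : ℝ, k ≠ 0 ∧ s' μ₀ = k • s) ∧
      ∀ᶠ μ in 𝓝 μ₀, A μ *ᵥ s' μ = σ' μ • s' μ := by
  have htr : AnalyticAt ℝ (fun μ => (A μ).trace) μ₀ := by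
    simp only [Matrix.trace_fin_three]
    exact ((hA 0 0).add (hA 1 1)).add (hA 2 2)
  have hsi : AnalyticAt ℝ (fun μ => (A μ).secondInvariant) μ₀ := by
    unfold Matrix.secondInvariant
    have := hA 0 0
    have := hA 0 1
    have := hA 0 2
    have := hA 1 0
    have := hA 1 1
    have := hA 1 2
    have := hA 2 0
    have := hA 2 1
    have := hA 2 2
    fun_prop
  have c1 := Matrix.charpoly_eq_zero_of_mulVec_eq hp.self_of_nhds.1 hp.self_of_nhds.2
  have c2 := Matrix.charpoly_eq_zero_of_mulVec_eq hs0 hs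
  have c3 := Matrix.charpoly_eq_zero_of_mulVec_eq hw0 hw
  -- `S` and `Q` are the sum and product of the two remaining eigenvalues, and `Δ` is the
  -- discriminant of their quadratic.
  set S : ℝ → ℝ := fun μ => (A μ).trace - l μ with hS
  set Q : ℝ → ℝ := fun μ => (A μ).secondInvariant - l μ * S μ with hQ
  have hSa : AnalyticAt ℝ S μ₀ := htr.sub hl
  have hQa : AnalyticAt ℝ Q μ₀ := hsi.sub (hl.mul hSa)
  set Δ : ℝ → ℝ := fun μ => S μ ^ 2 - 4 * Q μ with hΔ
  have hΔa : AnalyticAt ℝ Δ μ₀ := by fun_prop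
  have hS0 : S μ₀ = σ + γ := by
    have d1 : (l μ₀ - σ) * (l μ₀ ^ 2 + l μ₀ * σ + σ ^ 2 - (A μ₀).trace * (l μ₀ + σ)
        + (A μ₀).secondInvariant) = 0 := by linear_combination c1 - c2
    have d2 : (l μ₀ - γ) * (l μ₀ ^ 2 + l μ₀ * γ + γ ^ 2 - (A μ₀).trace * (l μ₀ + γ)
        + (A μ₀).secondInvariant) = 0 := by linear_combination c1 - c3
    have d1' := (mul_eq_zero.1 d1).resolve_left (sub_ne_zero.2 hlσ)
    have d2' := (mul_eq_zero.1 d2).resolve_left (sub_ne_zero.2 hlγ)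
    have d3 : (σ - γ) * (l μ₀ + σ + γ - (A μ₀).trace) = 0 := by linear_combination d1' - d2'
    have d3' := (mul_eq_zero.1 d3).resolve_left (sub_ne_zero.2 hσγ)
    simp only [hS]
    linarith
  have hQ0 : Q μ₀ = σ * γ := by
    have htr0 : (A μ₀).trace = l μ₀ + σ + γ := by simp only [hS] at hS0; linarith
    have d1 : (l μ₀ - σ) * (l μ₀ ^ 2 + l μ₀ * σ + σ ^ 2 - (A μ₀).trace * (l μ₀ + σ)
        + (A μ₀).secondInvariant) = 0 := by linear_combination c1 - c2
    have d1' := (mul_eq_zero.1 d1).resolve_left (sub_ne_zero.2 hlσ)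
    rw [htr0] at d1'
    simp only [hQ, hS0]
    linear_combination d1'
  have hΔ0 : Δ μ₀ = (σ - γ) ^ 2 := by
    simp only [hΔ, hS0, hQ0]; ring
  have hΔpos : 0 < Δ μ₀ := by
    rw [hΔ0]; exact sq_pos_of_ne_zero (sub_ne_zero.2 hσγ)
  -- The sign `ε` selects the root branch that passes through `σ`, rather than `γ`, at `μ₀`.
  obtain ⟨ε, hε, hε0⟩ : ∃ ε : ℝ, ε ^ 2 = 1 ∧ ε * √(Δ μ₀) = σ - γ := by
    rw [hΔ0, Real.sqrt_sq_eq_abs]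
    rcases le_total 0 (σ - γ) with h | h
    · exact ⟨1, by norm_num, by rw [abs_of_nonneg h, one_mul]⟩
    · exact ⟨-1, by norm_num, by rw [abs_of_nonpos h]; ring⟩
  have hra : AnalyticAt ℝ (fun μ => √(Δ μ)) μ₀ := hΔa.real_sqrt hΔpos.ne'
  set σ' : ℝ → ℝ := fun μ => (S μ + ε * √(Δ μ)) / 2 with hσ'
  set γ' : ℝ → ℝ := fun μ => (S μ - ε * √(Δ μ)) / 2 with hγ'
  have hγa : AnalyticAt ℝ γ' μ₀ := by fun_prop
  have hσ0 : σ' μ₀ = σ := by simp only [hσ', hS0, hε0]; ring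
  have hγ0 : γ' μ₀ = γ := by simp only [hγ', hS0, hε0]; ring
  -- The fixed vector `s` is projected, up to scale, onto the moving `σ'`-eigenspace; at `μ₀` the
  -- scale is `(σ - l)(σ - γ) ≠ 0`.
  refine ⟨σ', fun μ => ((A μ - l μ • (1 : Matrix (Fin 3) (Fin 3) ℝ)) * (A μ - γ' μ • 1)) *ᵥ s,
    fun i => ?_, hσ0, ⟨(σ - l μ₀) * (σ - γ), mul_ne_zero (sub_ne_zero.2 hlσ.symm)
      (sub_ne_zero.2 hσγ), ?_⟩, ?_⟩
  · have hent : ∀ (t : ℝ → ℝ), AnalyticAt ℝ t μ₀ → ∀ i j,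
        AnalyticAt ℝ (fun μ => (A μ - t μ • (1 : Matrix (Fin 3) (Fin 3) ℝ)) i j) μ₀ := by
      intro t ht i j
      simp only [Matrix.sub_apply, Matrix.smul_apply, smul_eq_mul]
      exact (hA i j).sub (ht.mul analyticAt_const)
    simp only [Matrix.mulVec, dotProduct, Matrix.mul_apply]
    refine Finset.analyticAt_fun_sum _ fun j _ => AnalyticAt.mul ?_ analyticAt_const
    exact Finset.analyticAt_fun_sum _ fun k _ => (hent l hl i k).mul (hent γ' hγa k j)
  · have hsub : ∀ t : ℝ, (A μ₀ - t • (1 : Matrix (Fin 3) (Fin 3) ℝ)) *ᵥ s = (σ - t) • s := fun t => by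
      rw [Matrix.sub_mulVec, Matrix.smul_mulVec, Matrix.one_mulVec, hs, sub_smul]
    beta_reduce
    rw [← Matrix.mulVec_mulVec, hsub, Matrix.mulVec_smul, hsub, hγ0, smul_smul, mul_comm]
  · have hΔev : ∀ᶠ μ in 𝓝 μ₀, 0 < Δ μ := hΔa.continuousAt.eventually (lt_mem_nhds hΔpos)
    filter_upwards [hp, hΔev] with μ hpμ hΔμ
    have hsq : √(Δ μ) ^ 2 = S μ ^ 2 - 4 * Q μ := Real.sq_sqrt hΔμ.le
    have hch := Matrix.charpoly_eq_zero_of_mulVec_eq hpμ.1 hpμ.2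
    have hsum : σ' μ + γ' μ = S μ := by simp only [hσ', hγ']; ring
    have hprod : σ' μ * γ' μ = Q μ := by
      simp only [hσ', hγ']
      linear_combination -(√(Δ μ) ^ 2) / 4 * hε - hsq / 4
    have t1 : (A μ).trace = l μ + σ' μ + γ' μ := by
      simp only [hS] at hsum; linarith
    have t2 : (A μ).secondInvariant = l μ * σ' μ + l μ * γ' μ + σ' μ * γ' μ := by
      rw [hprod]; simp only [hQ]; rw [← hsum]; ring
    have t3 : (A μ).det = l μ * σ' μ * γ' μ := by
      rw [t1, t2] at hch; linear_combination -hch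
    have hz := Matrix.mul_mul_eq_zero_of_charpoly t1 t2 t3
    have hz' := congrArg (fun B => B *ᵥ s) hz
    simp only [Matrix.zero_mulVec] at hz'
    rw [← Matrix.mulVec_mulVec, Matrix.sub_mulVec, Matrix.smul_mulVec, Matrix.one_mulVec] at hz'
    exact sub_eq_zero.1 hz'

/-! ### Orthonormal frames adapted to two eigenvectors -/

theorem frameMatrix_mulVec (a b x : Fin 3 → ℝ) :
    frameMatrix a b *ᵥ x = ![a ⬝ᵥ x, crossProduct b a ⬝ᵥ x, b ⬝ᵥ x] := by
  ext i
  fin_cases i <;> rfl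

/-- In an orthonormal frame adapted to two eigenvectors `b` and `κ a + τ b`, only five entries and
the pattern of the normal form are left. -/
theorem frameMatrix_conj {A : Matrix (Fin 3) (Fin 3) ℝ} {a b : Fin 3 → ℝ} {κ τ l σ : ℝ}
    (ha : a ⬝ᵥ a = 1) (hb : b ⬝ᵥ b = 1) (hab : a ⬝ᵥ b = 0) (hκ : κ ≠ 0)
    (hAb : A *ᵥ b = σ • b) (hAp : A *ᵥ (κ • a + τ • b) = l • (κ • a + τ • b)) :
    let B := frameMatrix a b * A * (frameMatrix a b)ᵀ
    B 0 2 = 0 ∧ B 1 2 = 0 ∧ B 2 2 = σ ∧ B 1 0 = 0 ∧ B 0 0 = l := by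
  intro B
  have hN := frameMatrix_isRotation ha hb hab
  have hNb : frameMatrix a b *ᵥ b = ![0, 0, 1] := by
    rw [frameMatrix_mulVec, hab, hb, dotProduct_comm, dot_self_cross]
  have hNa : frameMatrix a b *ᵥ a = ![1, 0, 0] := by
    rw [frameMatrix_mulVec, ha, dotProduct_comm b, hab, dotProduct_comm _ a, dot_cross_self]
  have h1 := hN.conj_mulVec hAb
  have h2 := hN.conj_mulVec hAp
  rw [Matrix.mulVec_add, Matrix.mulVec_smul, Matrix.mulVec_smul, hNa, hNb] at h2
  rw [hNb] at h1
  change B *ᵥ _ = _ at h1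
  change B *ᵥ _ = _ at h2
  have p0 := congrFun h1 0
  have p1 := congrFun h1 1
  have p2 := congrFun h1 2
  have q0 := congrFun h2 0
  have q1 := congrFun h2 1
  simp [Matrix.mulVec, dotProduct, Fin.sum_univ_three] at p0 p1 p2 q0 q1
  rw [p0] at q0
  rw [p1] at q1
  refine ⟨p0, p1, p2, ?_, ?_⟩
  · simpa [hκ] using q1
  · exact mul_right_cancel₀ hκ (by linarith)

theorem AnalyticAt.dotProduct {f g : ℝ → Fin 3 → ℝ} {x : ℝ}
    (hf : ∀ i, AnalyticAt ℝ (fun y => f y i) x) (hg : ∀ i, AnalyticAt ℝ (fun y => g y i) x) :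
    AnalyticAt ℝ (fun y => f y ⬝ᵥ g y) x :=
  Finset.analyticAt_fun_sum _ fun i _ => (hf i).mul (hg i)

theorem AnalyticAt.matrix_mul {f g : ℝ → Matrix (Fin 3) (Fin 3) ℝ} {x : ℝ}
    (hf : ∀ i j, AnalyticAt ℝ (fun y => f y i j) x) (hg : ∀ i j, AnalyticAt ℝ (fun y => g y i j) x)
    (i j : Fin 3) : AnalyticAt ℝ (fun y => (f y * g y) i j) x :=
  AnalyticAt.dotProduct (hf i) (fun k => hg k j)

theorem AnalyticAt.frameMatrix {f g : ℝ → Fin 3 → ℝ} {x : ℝ}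
    (hf : ∀ i, AnalyticAt ℝ (fun y => f y i) x) (hg : ∀ i, AnalyticAt ℝ (fun y => g y i) x)
    (i j : Fin 3) : AnalyticAt ℝ (fun y => frameMatrix (f y) (g y) i j) x := by
  have := hf 0
  have := hf 1
  have := hf 2
  have := hg 0
  have := hg 1
  have := hg 2
  fin_cases i <;> fin_cases j <;> simp [_root_.frameMatrix, cross_apply] <;> fun_prop

theorem dotProduct_self_pos_of_ne_zero {x : Fin 3 → ℝ} (hx : x ≠ 0) : 0 < x ⬝ᵥ x := by
  refine lt_of_le_of_ne ?_ fun h => hx (dotProduct_self_eq_zero.1 h.symm)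
  simp only [dotProduct]
  exact Finset.sum_nonneg fun i _ => mul_self_nonneg _

/-- Analytic dependence of the orthonormal frame adapted to two independent vectors. -/
theorem exists_analytic_frame {p s : ℝ → Fin 3 → ℝ} {μ₀ : ℝ}
    (hp : ∀ i, AnalyticAt ℝ (fun μ => p μ i) μ₀) (hs : ∀ i, AnalyticAt ℝ (fun μ => s μ i) μ₀)
    (hs0 : s μ₀ ≠ 0) (hps : ∀ k : ℝ, p μ₀ ≠ k • s μ₀) :
    ∃ (a b : ℝ → Fin 3 → ℝ) (n κ τ : ℝ → ℝ), (∀ i, AnalyticAt ℝ (fun μ => a μ i) μ₀) ∧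
      (∀ i, AnalyticAt ℝ (fun μ => b μ i) μ₀) ∧
      ∀ᶠ μ in 𝓝 μ₀, a μ ⬝ᵥ a μ = 1 ∧ b μ ⬝ᵥ b μ = 1 ∧ a μ ⬝ᵥ b μ = 0 ∧ n μ ≠ 0 ∧ κ μ ≠ 0 ∧
        b μ = n μ • s μ ∧ p μ = κ μ • a μ + τ μ • b μ := by
  -- Gram–Schmidt starting from `s`. The square roots are analytic because `s` and the part `q` of
  -- `p` orthogonal to it are nonzero at `μ₀`.
  set n : ℝ → ℝ := fun μ => (√(s μ ⬝ᵥ s μ))⁻¹ with hn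
  set b : ℝ → Fin 3 → ℝ := fun μ => n μ • s μ with hb
  set τ : ℝ → ℝ := fun μ => p μ ⬝ᵥ b μ with hτ
  set q : ℝ → Fin 3 → ℝ := fun μ => p μ - τ μ • b μ with hq
  set κ : ℝ → ℝ := fun μ => √(q μ ⬝ᵥ q μ) with hκ
  have hss : AnalyticAt ℝ (fun μ => s μ ⬝ᵥ s μ) μ₀ := AnalyticAt.dotProduct hs hs
  have hss0 := dotProduct_self_pos_of_ne_zero hs0
  have hna : AnalyticAt ℝ n μ₀ := (hss.real_sqrt hss0.ne').inv (Real.sqrt_pos.2 hss0).ne'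
  have hba : ∀ i, AnalyticAt ℝ (fun μ => b μ i) μ₀ := fun i => hna.mul (hs i)
  have hτa : AnalyticAt ℝ τ μ₀ := AnalyticAt.dotProduct hp hba
  have hqa : ∀ i, AnalyticAt ℝ (fun μ => q μ i) μ₀ := fun i => (hp i).sub (hτa.mul (hba i))
  have hqq : AnalyticAt ℝ (fun μ => q μ ⬝ᵥ q μ) μ₀ := AnalyticAt.dotProduct hqa hqa
  have hqq0 : 0 < q μ₀ ⬝ᵥ q μ₀ := dotProduct_self_pos_of_ne_zero fun h =>
    hps (τ μ₀ * n μ₀) (by rw [← smul_smul]; exact sub_eq_zero.1 h)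
  have hκa : AnalyticAt ℝ (fun μ => (κ μ)⁻¹) μ₀ :=
    (hqq.real_sqrt hqq0.ne').inv (Real.sqrt_pos.2 hqq0).ne'
  refine ⟨fun μ => (κ μ)⁻¹ • q μ, b, n, κ, τ, fun i => hκa.mul (hqa i), hba, ?_⟩
  filter_upwards [hss.continuousAt.eventually (lt_mem_nhds hss0),
    hqq.continuousAt.eventually (lt_mem_nhds hqq0)] with μ h1 h2
  have hn0 := (Real.sqrt_pos.2 h1).ne'
  have hκ0 : κ μ ≠ 0 := (Real.sqrt_pos.2 h2).ne'
  have hnsq : √(s μ ⬝ᵥ s μ) ^ 2 = s μ ⬝ᵥ s μ := Real.sq_sqrt h1.le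
  have hκsq : κ μ ^ 2 = q μ ⬝ᵥ q μ := Real.sq_sqrt h2.le
  have hbb : b μ ⬝ᵥ b μ = 1 := by
    simp only [hb, hn, smul_dotProduct, dotProduct_smul, smul_eq_mul]
    generalize √(s μ ⬝ᵥ s μ) = r at hn0 hnsq ⊢
    rw [← hnsq]
    field_simp
  refine ⟨?_, hbb, ?_, inv_ne_zero hn0, hκ0, rfl, ?_⟩
  · simp only [smul_dotProduct, dotProduct_smul, smul_eq_mul, ← hκsq]
    field_simp
  · have : q μ ⬝ᵥ b μ = 0 := by
      simp only [hq, sub_dotProduct, smul_dotProduct, hbb, hτ, smul_eq_mul]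
      ring
    rw [smul_dotProduct, this, smul_zero]
  · rw [smul_inv_smul₀ hκ0]
    simp only [hq]
    abel

/-! ### The normal form and its nondegeneracy -/

theorem PolyField.normalForm_vec_eq_cross {B : Matrix (Fin 3) (Fin 3) ℝ} (h02 : B 0 2 = 0)
    (h12 : B 1 2 = 0) (h10 : B 1 0 = 0) (y : Fin 3 → ℝ) :
    crossProduct y (B *ᵥ y) =
      (PolyField.normalForm (B 2 0) (B 2 1) (B 2 2 - B 1 1) (B 0 0 - B 2 2) (B 0 1)).vec y := by
  rw [cross_apply]
  ext i
  fin_cases i <;>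
    simp [PolyField.normalForm, PolyField.vec, Matrix.mulVec, dotProduct, Fin.sum_univ_three, h02,
      h12, h10] <;> ring

/-- Nondegeneracy of the normal form: the eigenvector `e₃` is orthogonal to neither of the other
eigenvectors `(κ, 0, τ)` and `w`. -/
theorem normalForm_nondegenerate {B : Matrix (Fin 3) (Fin 3) ℝ} (h02 : B 0 2 = 0)
    (h12 : B 1 2 = 0) (h10 : B 1 0 = 0) {l σ γ κ τ : ℝ} {w : Fin 3 → ℝ} (h22 : B 2 2 = σ)
    (h00 : B 0 0 = l) (hp : B *ᵥ ![κ, 0, τ] = l • ![κ, 0, τ]) (hτ : τ ≠ 0)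
    (hw : B *ᵥ w = γ • w) (hw2 : w 2 ≠ 0) (hlγ : l ≠ γ) (hpos : 0 < (σ - γ) * (l - σ)) :
    B 2 0 ≠ 0 ∧ B 2 1 * (B 2 2 - B 1 1 + (B 0 0 - B 2 2)) - B 2 0 * B 0 1 ≠ 0 ∧
      -((B 2 2 - B 1 1) * (B 0 0 - B 2 2)) < 0 := by
  have hσγ : σ - γ ≠ 0 := left_ne_zero_of_mul hpos.ne'
  have hlσ : l - σ ≠ 0 := right_ne_zero_of_mul hpos.ne'
  have p2 := congrFun hp 2
  have w0 := congrFun hw 0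
  have w1 := congrFun hw 1
  have w2 := congrFun hw 2
  simp [Matrix.mulVec, dotProduct, Fin.sum_univ_three, h02, h12, h10, h22, h00] at p2 w0 w1 w2
  -- If `w 1 = 0`, then `w` lies in the invariant plane of `e₁, e₃`, where the eigenvalues are `l`
  -- and `σ`, both different from `γ`.
  have hy : w 1 ≠ 0 := fun hy => by
    have hx : (l - γ) * w 0 = 0 := by rw [hy] at w0; linear_combination w0
    have hx' := (mul_eq_zero.1 hx).resolve_left (sub_ne_zero.2 hlγ)
    have ht : (σ - γ) * w 2 = 0 := by rw [hy, hx'] at w2; linear_combination w2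
    exact hw2 ((mul_eq_zero.1 ht).resolve_left hσγ)
  have h11 : B 1 1 = γ := w1.resolve_right hy
  rw [h11, h22, h00]
  -- The third row on `(κ, 0, τ)` reads `B₂₀ κ = (l - σ) τ ≠ 0`. Eliminating `w 0` from the rows of
  -- `B w = γ w` shows that the second quantity times `w 1` is `-(l - γ)(σ - γ) w₂ ≠ 0`. The third
  -- is `-(σ - γ)(l - σ)`.
  refine ⟨fun h => ?_, fun h => ?_, by linarith⟩
  · have : (l - σ) * τ = 0 := by rw [h] at p2; linear_combination -p2
    exact hτ ((mul_eq_zero.1 this).resolve_left hlσ)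
  · have : (l - γ) * ((σ - γ) * w 2) = 0 := by
      linear_combination (l - γ) * w2 - B 2 0 * w0 - w 1 * h
    exact hw2 ((mul_eq_zero.1 ((mul_eq_zero.1 this).resolve_left
      (sub_ne_zero.2 hlγ))).resolve_left hσγ)

theorem PolyField.IsAnalyticFamily.analyticAt_crossMatrix {J : Set ℝ} {X : ℝ → PolyField}
    (hX : PolyField.IsAnalyticFamily J X) {μ : ℝ} (hμ : μ ∈ J) (i j : Fin 3) :
    AnalyticAt ℝ (fun μ => (X μ).crossMatrix i j) μ := by
  have h : ∀ i j k, AnalyticAt ℝ (fun μ => (X μ i).quadCoeff j k) μ := fun i j k => hX.2 i _ μ hμ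
  fin_cases i <;> fin_cases j <;> simp only [PolyField.crossMatrix] <;>
    first | exact h _ _ _ | exact (h _ _ _).neg | exact analyticAt_const

/-- The normal form near a singularity with three simple real eigenvalues, in nondegenerate
position. -/
theorem exists_analytic_normalizing_rotation {A : ℝ → Matrix (Fin 3) (Fin 3) ℝ} {μ₀ : ℝ}
    (hA : ∀ i j, AnalyticAt ℝ (fun μ => A μ i j) μ₀) {p : ℝ → Fin 3 → ℝ}
    (hpa : ∀ i, AnalyticAt ℝ (fun μ => p μ i) μ₀)
    (hp : ∀ᶠ μ in 𝓝 μ₀, p μ ⬝ᵥ p μ = 1 ∧ A μ *ᵥ p μ = (p μ ⬝ᵥ A μ *ᵥ p μ) • p μ)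
    {l σ γ : ℝ} {s w : Fin 3 → ℝ} (hl : A μ₀ *ᵥ p μ₀ = l • p μ₀) (hs : A μ₀ *ᵥ s = σ • s)
    (hw : A μ₀ *ᵥ w = γ • w) (hpos : 0 < (σ - γ) * (l - σ)) (hps : p μ₀ ⬝ᵥ s ≠ 0)
    (hsw : s ⬝ᵥ w ≠ 0) :
    ∃ N : ℝ → Matrix (Fin 3) (Fin 3) ℝ, (∀ i j, AnalyticAt ℝ (fun μ => N μ i j) μ₀) ∧
      (∀ᶠ μ in 𝓝 μ₀, (N μ).IsRotation ∧ (N μ * A μ * (N μ)ᵀ) 0 2 = 0 ∧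
        (N μ * A μ * (N μ)ᵀ) 1 2 = 0 ∧ (N μ * A μ * (N μ)ᵀ) 1 0 = 0) ∧
      let B := N μ₀ * A μ₀ * (N μ₀)ᵀ
      B 2 0 ≠ 0 ∧ B 2 1 * (B 2 2 - B 1 1 + (B 0 0 - B 2 2)) - B 2 0 * B 0 1 ≠ 0 ∧
        -((B 2 2 - B 1 1) * (B 0 0 - B 2 2)) < 0 := by
  have hσγ : σ ≠ γ := fun h => by rw [h, sub_self, zero_mul] at hpos; exact lt_irrefl _ hpos
  have hlσ : l ≠ σ := fun h => by rw [h, sub_self, mul_zero] at hpos; exact lt_irrefl _ hpos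
  have hlγ : l ≠ γ := fun h => by rw [h] at hpos; nlinarith [sq_nonneg (σ - γ)]
  have hs0 : s ≠ 0 := fun h => hps (by rw [h, dotProduct_zero])
  have hw0 : w ≠ 0 := fun h => hsw (by rw [h, dotProduct_zero])
  have hpp := hp.self_of_nhds.1
  have hl0 : p μ₀ ⬝ᵥ A μ₀ *ᵥ p μ₀ = l := by rw [hl, dotProduct_smul, hpp, smul_eq_mul, mul_one]
  have hla : AnalyticAt ℝ (fun μ => p μ ⬝ᵥ A μ *ᵥ p μ) μ₀ :=
    AnalyticAt.dotProduct hpa fun i => AnalyticAt.dotProduct (hA i) hpa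
  have hp' : ∀ᶠ μ in 𝓝 μ₀, p μ ≠ 0 ∧ A μ *ᵥ p μ = (p μ ⬝ᵥ A μ *ᵥ p μ) • p μ := by
    filter_upwards [hp] with μ h
    exact ⟨fun h0 => by rw [h0, dotProduct_zero] at h; exact zero_ne_one h.1, h.2⟩
  obtain ⟨σ', s', hsa, hσ0, ⟨k, hk, hsk⟩, hev⟩ := exists_analytic_eigenvector hA hla hp' hs0 hs hw0
    hw hσγ (by rwa [hl0]) (by rwa [hl0])
  have hs'0 : s' μ₀ ≠ 0 := hsk ▸ smul_ne_zero hk hs0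
  -- If `p` were parallel to `s'`, it would have both eigenvalues `l` and `σ`.
  have hpar : ∀ k : ℝ, p μ₀ ≠ k • s' μ₀ := fun k' h => by
    have h1 : A μ₀ *ᵥ p μ₀ = σ • p μ₀ := by
      rw [h, hsk, smul_smul, Matrix.mulVec_smul, hs, smul_comm]
    rw [hl] at h1
    exact hlσ (smul_left_injective ℝ hp'.self_of_nhds.1 h1)
  obtain ⟨a, b, n, κ, τ, haa, hba, hfr⟩ := exists_analytic_frame hpa hsa hs'0 hpar
  have hconj : ∀ᶠ μ in 𝓝 μ₀, (frameMatrix (a μ) (b μ)).IsRotation ∧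
      let B := frameMatrix (a μ) (b μ) * A μ * (frameMatrix (a μ) (b μ))ᵀ
      B 0 2 = 0 ∧ B 1 2 = 0 ∧ B 2 2 = σ' μ ∧ B 1 0 = 0 ∧ B 0 0 = p μ ⬝ᵥ A μ *ᵥ p μ := by
    filter_upwards [hfr, hp, hev] with μ ⟨h1, h2, h3, h4, h5, h6, h7⟩ h8 h9
    refine ⟨frameMatrix_isRotation h1 h2 h3, frameMatrix_conj (κ := κ μ) (τ := τ μ) h1 h2 h3 h5 ?_ ?_⟩
    · rw [h6, Matrix.mulVec_smul, h9, smul_comm]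
    · rw [← h7]; exact h8.2
  refine ⟨fun μ => frameMatrix (a μ) (b μ), AnalyticAt.frameMatrix haa hba,
    hconj.mono fun μ ⟨h1, h2, h3, _, h5, _⟩ => ⟨h1, h2, h3, h5⟩, ?_⟩
  obtain ⟨hN, h02, h12, h22, h10, h00⟩ := hconj.self_of_nhds
  obtain ⟨h1, h2, h3, h4, h5, h6, h7⟩ := hfr.self_of_nhds
  have hcross1 : crossProduct (b μ₀) (a μ₀) ⬝ᵥ a μ₀ = 0 := by
    rw [dotProduct_comm, dot_cross_self]
  have hcross2 : crossProduct (b μ₀) (a μ₀) ⬝ᵥ b μ₀ = 0 := by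
    rw [dotProduct_comm, dot_self_cross]
  have hNp : frameMatrix (a μ₀) (b μ₀) *ᵥ p μ₀ = ![κ μ₀, 0, τ μ₀] := by
    rw [frameMatrix_mulVec, h7]
    simp only [dotProduct_add, dotProduct_smul, h1, h2, h3, hcross1, hcross2,
      dotProduct_comm (b μ₀) (a μ₀), smul_eq_mul]
    simp
  have hτ : τ μ₀ ≠ 0 := fun h => by
    have h8 : b μ₀ ⬝ᵥ p μ₀ = 0 := by
      rw [h7, h, dotProduct_add, dotProduct_smul, dotProduct_comm, h3]; simp
    rw [h6, hsk, smul_dotProduct, smul_dotProduct, dotProduct_comm] at h8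
    exact (mul_ne_zero h4 (mul_ne_zero hk hps)) h8
  have hw2 : (frameMatrix (a μ₀) (b μ₀) *ᵥ w) 2 ≠ 0 := by
    rw [frameMatrix_mulVec, h6, hsk]
    simp only [Matrix.cons_val, smul_dotProduct, smul_eq_mul]
    exact mul_ne_zero h4 (mul_ne_zero hk hsw)
  have hBp := hN.conj_mulVec hl
  rw [hNp] at hBp
  exact normalForm_nondegenerate h02 h12 h10 (h22.trans hσ0) (h00.trans hl0) hBp hτ
    (hN.conj_mulVec hw) hw2 hlγ hpos

theorem theorem6 (J : Set ℝ) (hJ : IsOpen J) (X : ℝ → PolyField)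
    (hX : PolyField.IsAnalyticFamily J X) (μ₀ : ℝ) (hμ₀ : μ₀ ∈ J)
    (hopf : PolyField.HasHopfBifurcationAt X μ₀) :
    ∃ J' : Set ℝ, IsOpen J' ∧ μ₀ ∈ J' ∧ J' ⊆ J ∧
      ∃ (M : ℝ → Matrix (Fin 3) (Fin 3) ℝ) (a₁ a₂ a₅ a₇ a₈ : ℝ → ℝ),
        (∀ i j, AnalyticOnNhd ℝ (fun μ => M μ i j) J') ∧
        AnalyticOnNhd ℝ a₁ J' ∧ AnalyticOnNhd ℝ a₂ J' ∧ AnalyticOnNhd ℝ a₅ J' ∧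
        AnalyticOnNhd ℝ a₇ J' ∧ AnalyticOnNhd ℝ a₈ J' ∧
        ∀ μ ∈ J',
          M μ ∈ Matrix.orthogonalGroup (Fin 3) ℝ ∧
          (∀ x : Fin 3 → ℝ, (M μ).mulVec ((X μ).vec x) =
            (PolyField.normalForm (a₁ μ) (a₂ μ) (a₅ μ) (a₇ μ) (a₈ μ)).vec ((M μ).mulVec x)) ∧
          a₁ μ ≠ 0 ∧ a₂ μ * (a₅ μ + a₇ μ) - a₁ μ * a₈ μ ≠ 0 ∧ -(a₅ μ * a₇ μ) < 0 := by
  obtain ⟨p, hpa, hsing, hfocus, -⟩ := hopf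
  have hJev : ∀ᶠ μ in 𝓝 μ₀, μ ∈ J := hJ.mem_nhds hμ₀
  obtain ⟨l, σ, γ, s, w, hl, hs, hw, hpos, hps, hsw⟩ :=
    (hX.1 μ₀ hμ₀).exists_eigenvectors_of_isWeakFocus hfocus
  have hA := hX.analyticAt_crossMatrix hμ₀
  obtain ⟨N, hNa, hNev, hnd₁, hnd₂, hnd₃⟩ := exists_analytic_normalizing_rotation hA
    (analyticAt_pi_iff.1 hpa) (by
      filter_upwards [hsing, hJev] with μ h1 h2
      exact (hX.1 μ h2).crossMatrix_mulVec_singularity h1) hl hs hw hpos hps hsw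
  set B : ℝ → Matrix (Fin 3) (Fin 3) ℝ := fun μ => N μ * (X μ).crossMatrix * (N μ)ᵀ with hB
  have hBa : ∀ i j, AnalyticAt ℝ (fun μ => B μ i j) μ₀ :=
    AnalyticAt.matrix_mul (AnalyticAt.matrix_mul hNa hA) fun i j => hNa j i
  have h5a : AnalyticAt ℝ (fun μ => B μ 2 2 - B μ 1 1) μ₀ := (hBa 2 2).sub (hBa 1 1)
  have h7a : AnalyticAt ℝ (fun μ => B μ 0 0 - B μ 2 2) μ₀ := (hBa 0 0).sub (hBa 2 2)
  have hc₂ : ContinuousAt (fun μ => B μ 2 1 * (B μ 2 2 - B μ 1 1 + (B μ 0 0 - B μ 2 2))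
      - B μ 2 0 * B μ 0 1) μ₀ :=
    (((hBa 2 1).mul (h5a.add h7a)).sub ((hBa 2 0).mul (hBa 0 1))).continuousAt
  have hc₃ : ContinuousAt (fun μ => -((B μ 2 2 - B μ 1 1) * (B μ 0 0 - B μ 2 2))) μ₀ :=
    (h5a.mul h7a).neg.continuousAt
  have hNan : ∀ᶠ μ in 𝓝 μ₀, ∀ i j, AnalyticAt ℝ (fun μ => N μ i j) μ :=
    eventually_all.2 fun i => eventually_all.2 fun j => (hNa i j).eventually_analyticAt
  -- Analyticity at a point and the three inequalities are open conditions, so all requirements hold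
  -- on a common neighbourhood.
  have hall := hJev.and (hNan.and (hNev.and (((hBa 2 0).eventually_analyticAt).and
    ((hBa 2 1).eventually_analyticAt.and (h5a.eventually_analyticAt.and
    (h7a.eventually_analyticAt.and ((hBa 0 1).eventually_analyticAt.and
    (((hBa 2 0).continuousAt.eventually_ne hnd₁).and ((hc₂.eventually_ne hnd₂).and
    (hc₃.eventually (gt_mem_nhds hnd₃)))))))))))
  obtain ⟨J', hJ', hJo, hJμ⟩ := eventually_nhds_iff.1 hall
  refine ⟨J', hJo, hJμ, fun μ hμ => (hJ' μ hμ).1, N, fun μ => B μ 2 0, fun μ => B μ 2 1,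
    fun μ => B μ 2 2 - B μ 1 1, fun μ => B μ 0 0 - B μ 2 2, fun μ => B μ 0 1,
    fun i j μ hμ => (hJ' μ hμ).2.1 i j, fun μ hμ => (hJ' μ hμ).2.2.2.1,
    fun μ hμ => (hJ' μ hμ).2.2.2.2.1, fun μ hμ => (hJ' μ hμ).2.2.2.2.2.1,
    fun μ hμ => (hJ' μ hμ).2.2.2.2.2.2.1, fun μ hμ => (hJ' μ hμ).2.2.2.2.2.2.2.1,
    fun μ hμ => ?_⟩
  obtain ⟨hμJ, -, ⟨hrot, h02, h12, h10⟩, -, -, -, -, -, hne⟩ := hJ' μ hμ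
  refine ⟨hrot.mem_orthogonalGroup, fun x => ?_, hne⟩
  rw [(hX.1 μ hμJ).vec_eq_cross, hrot.mulVec_cross_mulVec]
  exact PolyField.normalForm_vec_eq_cross h02 h12 h10 _
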